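/- **Setting.** Let $M$ be a closed manifold of dimension $s+1+u$ and $f$ a $C^1$ diffeomorphism of $M$. Multipliers of a periodic point $P$ of (least) period $\pi(P)$ are the eigenvalues of $Df^{\pi(P)}(P)$, counted with multiplicity; $P$ is hyperbolic if none has modulus $1$; its index is the number of multipliers of modulus $>1$. A *simple cycle* of $f$ associated to periodic points $A$, $B$ with distinct orbits, with a neighborhood $V_0$, consists of the following. - $C^1$ coordinates in $\mathbb R^s\times\mathbb R\times\mathbb R^u$ on neighborhoods $U_A\ni A$, $U_B\ni B$, with $A$, resp. $B$, at the origin, in which $f^{\pi(A)}$, resp. $f^{\pi(B)}$, is linear of the form $(x^s,x,x^u)\mapsto(L^s x^s,\lambda^c x, L^u x^u)$, where the eigenvalues of $L^s$ have modulus $<\min(1,|\lambda^c|)$ and those of $L^u$ have modulus $>\max(1,|\lambda^c|)$. The number $\lambda^c$ (the $(s+1)$-th multiplier) is the central multiplier, and $|\lambda^c(A)|<1<|\lambda^c(B)|$. In particular $A$ and $B$ are hyperbolic and $\mathrm{index}(A)=u=\mathrm{index}(B)-1$. - Heteroclinic points $X^-\in W^u_{loc}(B)\subset U_B$ with $X^+=f^{t_{(b,a)}}(X^-)\in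 W^s_{loc}(A)\subset U_A$, and $Y^-\in W^u_{loc}(A)\subset U_A$ with $Y^+=f^{t_{(a,b)}}(Y^-)\in W^s_{loc}(B)\subset U_B$, for some transition times $t_{(b,a)},t_{(a,b)}\ge1$. - In the coordinates, $f^{t_{(b,a)}}$ near $X^-$ and $f^{t_{(a,b)}}$ near $Y^-$ are of the form $(T^s,T^c,T^u)$, where $T^s$ and $(T^u)^{-1}$ are affine contractions and $T^c$ is an affine isometry of $\mathbb R$; moreover $T^c_{(a,b)}$ is linear. (Hence the orbit of $X^-$ is a transverse and that of $Y^-$ a quasi-transverse heteroclinic intersection.) - $V_0$ is an open set containing the orbits of $A$, $B$, $X^-$, $Y^-$. An *unfolding* of the cycle is a family $(f_\nu)_{|\nu|<\nu_0}$ of $C^1$ diffeomorphisms with $f_0=f$ and $f_\nu\to f$ in the $C^1$ topology as $\nu\to0$, such that there is a closed neighborhood $W$ of $Y^+$, containing no other point of the orbits of the cycle, with $f_\nu(z)=f(z)$ whenever $f(z)\notin W$, and such that, in the coordinates, on a neighborhood of $Y^-$ independent of $\nu$, $$f_\nu^{t_{(a,b)}}=f^{t_{(a,b)}}+(0^s,\nu,0^u).$$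 **Lemma.** Let $(f_\nu)$ be an unfolding of a simple cycle, and write $X^-=(x^s,c,x^u)$ in the coordinates of $U_B$. Then $x^s=0$, and for all large $\ell$ and $m$ there are $\nu_{\ell,m}$ with $\nu_{\ell,m}\to0$ as $\ell,m\to\infty$ and a periodic point $R_{\ell,m}\in U_B$ of $f_{\nu_{\ell,m}}$ whose entire orbit lies in $V_0$, such that: 1. in the coordinates of $U_B$, $R_{\ell,m}=(r^s_{\ell,m},\,c,\,x^u+r^u_{\ell,m})$ with $|r^s_{\ell,m}|\to0$ and $|r^u_{\ell,m}|\to0$ as $\ell,m\to\infty$ (so, if $X^-=(0^s,c,0^u)$, the strong coordinates of $R_{\ell,m}$ tend to $0$); 2. the (least) period of $R_{\ell,m}$ is $m\,\pi(B)+\ell\,\pi(A)+t_{(a,b)}+t_{(b,a)}$; 3. $R_{\ell,m}$ has $s$ multipliers of modulus $<\min(1,|\lambda^c(R_{\ell,m})|)$, $u$ multipliers of modulus $>\max(1,|\lambda^c(R_{\ell,m})|)$, and one remaining real multiplier, its central multiplier $\lambda^c(R_{\ell,m})$, with $|\lambda^c(R_{\ell,m})|=|\lambda^c(B)^m\,\lambda^c(A)^\ell|$;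 4. if $R_{\ell,m}$ is hyperbolic, then either $|\lambda^c(R_{\ell,m})|<1$ and $\mathrm{index}(R_{\ell,m})=\mathrm{index}(A)$, or $|\lambda^c(R_{\ell,m})|>1$ and $\mathrm{index}(R_{\ell,m})=\mathrm{index}(B)$. -/

import Mathlib

open Filter Function
open scoped Manifold Topology

noncomputable section

namespace HeteroCycle

/-- The eigenvalues of a real endomorphism, in `ℂ`, with algebraic multiplicity. -/
def eigenvalues {E : Type*} [AddCommGroup E] [Module ℝ E] [Module.Finite ℝ E]
    (L : E →ₗ[ℝ] E) : Multiset ℂ :=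
  (L.charpoly.map (algebraMap ℝ ℂ)).roots

/-- `μ` is the `(s+1)`-th element, in the order of increasing moduli, of the list of multipliers
`Λ`; the `s` multipliers before it lie inside the open unit disc and have modulus `< |μ|`, the
ones after it lie outside the closed unit disc and have modulus `> |μ|`. -/
def IsCentralMultiplier (s : ℕ) (Λ : Multiset ℂ) (μ : ℝ) : Prop :=
  ∃ S U : Multiset ℂ, Λ = S + {(μ : ℂ)} + U ∧ Multiset.card S = s ∧
    (∀ z ∈ S, ‖z‖ < |μ| ∧ ‖z‖ < 1) ∧ (∀ z ∈ U, |μ| < ‖z‖ ∧ 1 < ‖z‖)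

section Dynamics

variable {M : Type*}

/-- The full (forward and backward) orbit of `p` under a bijection `f`. -/
def fullOrbit (f : M → M) (p : M) : Set M :=
  {q | ∃ n : ℕ, f^[n] p = q ∨ f^[n] q = p}

/-- The maximal invariant set of the bijection `f` in `V`: the points whose full orbit
lies in `V`. -/
def maximalInvariantSet (f : M → M) (V : Set M) : Set M :=
  {x | fullOrbit f x ⊆ V}

/-- For a periodic point `p` of `f` of period `n`: the local stable set of `p` in `U`, i.e. the
points whose forward orbit under `f ^ n` stays in `U` and converges to `p`. Applied to the inverse
of `f` it is the local unstable set. -/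
def localStableSet [TopologicalSpace M] (f : M → M) (n : ℕ) (p : M) (U : Set M) : Set M :=
  {x | (∀ k : ℕ, f^[n * k] x ∈ U) ∧ Tendsto (fun k : ℕ => f^[n * k] x) atTop (𝓝 p)}

variable {d : ℕ} [TopologicalSpace M] [ChartedSpace (EuclideanSpace ℝ (Fin d)) M]

/-- The multipliers of a periodic point `p` of `f`: the eigenvalues of the derivative at `p` of
`f ^ π`, where `π` is the (least) period of `p`. As `f ^ π` fixes `p`, its derivative is an
endomorphism of the tangent space at `p`. -/
def multipliers (f : M → M) (p : M) : Multiset ℂ :=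
  let L : EuclideanSpace ℝ (Fin d) →L[ℝ] EuclideanSpace ℝ (Fin d) :=
    mfderiv (𝓡 d) (𝓡 d) (f^[minimalPeriod f p]) p
  eigenvalues (L : EuclideanSpace ℝ (Fin d) →ₗ[ℝ] EuclideanSpace ℝ (Fin d))

/-- Hyperbolicity of a periodic point: no multiplier on the unit circle. -/
def IsHyperbolicAt (d : ℕ) [ChartedSpace (EuclideanSpace ℝ (Fin d)) M] (f : M → M) (p : M) :
    Prop :=
  p ∈ periodicPts f ∧ ∀ z ∈ multipliers (d := d) f p, ‖z‖ ≠ 1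

open Classical in
/-- The index of a periodic point: the dimension of its unstable bundle, i.e. the number of
multipliers outside the closed unit disc. -/
def index (d : ℕ) [ChartedSpace (EuclideanSpace ℝ (Fin d)) M] (f : M → M) (p : M) : ℕ :=
  Multiset.card ((multipliers (d := d) f p).filter fun z => 1 < ‖z‖)

end Dynamics

/-- The coordinate space `ℝ^s × ℝ × ℝ^u` (strong stable, central, strong unstable). -/
abbrev Coord (s u : ℕ) : Type :=
  EuclideanSpace ℝ (Fin s) × ℝ × EuclideanSpace ℝ (Fin u)

/-- A block map `(T^s, T^c, T^u)` of `ℝ^s × ℝ × ℝ^u` in which `T^s` and `(T^u)⁻¹` are affine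
contractions and `T^c` is an affine isometry. -/
structure AffineTransition (s u : ℕ) where
  Ts : EuclideanSpace ℝ (Fin s) →ᵃ[ℝ] EuclideanSpace ℝ (Fin s)
  Tc : ℝ →ᵃⁱ[ℝ] ℝ
  Tu : EuclideanSpace ℝ (Fin u) ≃ᵃ[ℝ] EuclideanSpace ℝ (Fin u)
  contracting_s : ∃ K, ContractingWith K Ts
  contracting_u : ∃ K, ContractingWith K Tu.symm

/-- The map of `ℝ^s × ℝ × ℝ^u` given by a transition. -/
def AffineTransition.toFun {s u : ℕ} (T : AffineTransition s u) (x : Coord s u) : Coord s u :=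
  (T.Ts x.1, T.Tc x.2.1, T.Tu x.2.2)

section Cycle

variable {s u : ℕ} {M : Type*} [TopologicalSpace M]
  [ChartedSpace (EuclideanSpace ℝ (Fin (s + 1 + u))) M]

/-- `C¹` coordinates on a neighbourhood `chart.source` of the periodic point `p` in which `f ^ π`
(`π` the period of `p`) is the linear map `(Ls, lam, Lu)` of `ℝ^s × ℝ × ℝ^u`. The splitting
`ℝ^s ⊕ ℝ ⊕ ℝ^u` is dominated, `ℝ^s` is contracted and `ℝ^u` is expanded; so `lam` is the
`(s+1)`-th multiplier of `p`. -/
structure LinearizingChart (f : M → M) (p : M) where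
  chart : OpenPartialHomeomorph M (Coord s u)
  contMDiffOn_chart :
    ContMDiffOn (𝓡 (s + 1 + u)) (modelWithCornersSelf ℝ (Coord s u)) 1 chart chart.source
  contMDiffOn_symm :
    ContMDiffOn (modelWithCornersSelf ℝ (Coord s u)) (𝓡 (s + 1 + u)) 1 chart.symm chart.target
  mem_source : p ∈ chart.source
  map_center : chart p = 0
  Ls : EuclideanSpace ℝ (Fin s) →ₗ[ℝ] EuclideanSpace ℝ (Fin s)
  lam : ℝ
  Lu : EuclideanSpace ℝ (Fin u) →ₗ[ℝ] EuclideanSpace ℝ (Fin u)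
  linear : ∀ z ∈ chart.source, f^[minimalPeriod f p] z ∈ chart.source →
    chart (f^[minimalPeriod f p] z) =
      (Ls (chart z).1, lam * (chart z).2.1, Lu (chart z).2.2)
  strong_stable : ∀ z ∈ eigenvalues Ls, ‖z‖ < |lam| ∧ ‖z‖ < 1
  strong_unstable : ∀ z ∈ eigenvalues Lu, |lam| < ‖z‖ ∧ 1 < ‖z‖

/-- A simple (co-index one, heterodimensional) cycle of `f` associated to saddles `A` and `B` with
`index A + 1 = index B`, together with a neighbourhood `V₀` of it.

`Xm = X⁻` (near `B`) and `Xp = X⁺ = f ^ tba (X⁻)` (near `A`) are the two ends of the transition of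
the heteroclinic orbit in `W^s(A) ∩ W^u(B)`; `Ym = Y⁻` (near `A`) and `Yp = Y⁺ = f ^ tab (Y⁻)`
(near `B`) those of the heteroclinic orbit in `W^u(A) ∩ W^s(B)`. In the coordinates the local
invariant manifolds are coordinate subspaces and the transitions are block maps, which makes the
first intersection transverse and the second one quasi-transverse. -/
structure SimpleCycle (s u : ℕ) {M : Type*} [TopologicalSpace M]
    [ChartedSpace (EuclideanSpace ℝ (Fin (s + 1 + u))) M]
    (f : Diffeomorph (𝓡 (s + 1 + u)) (𝓡 (s + 1 + u)) M M 1) where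
  A : M
  B : M
  periodic_A : A ∈ periodicPts f
  periodic_B : B ∈ periodicPts f
  orbits_ne : ∀ n : ℕ, f^[n] A ≠ B
  chartA : LinearizingChart (s := s) (u := u) f A
  chartB : LinearizingChart (s := s) (u := u) f B
  /-- The central multiplier of `A` is contracting, that of `B` is expanding. -/
  central_A : |chartA.lam| < 1
  central_B : 1 < |chartB.lam|
  Xm : M
  Ym : M
  /-- The transition times. -/
  tba : ℕ
  tab : ℕ
  tba_pos : 0 < tba
  tab_pos : 0 < tab
  Xm_mem : Xm ∈ localStableSet f.symm (minimalPeriod f B) B chartB.chart.source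
  Xp_mem : f^[tba] Xm ∈ localStableSet f (minimalPeriod f A) A chartA.chart.source
  Ym_mem : Ym ∈ localStableSet f.symm (minimalPeriod f A) A chartA.chart.source
  Yp_mem : f^[tab] Ym ∈ localStableSet f (minimalPeriod f B) B chartB.chart.source
  /-- The transition from `B` to `A`. -/
  Tba : AffineTransition s u
  /-- The transition from `A` to `B`. -/
  Tab : AffineTransition s u
  Tba_eq : ∀ᶠ z in 𝓝 Xm, f^[tba] z ∈ chartA.chart.source ∧
    chartA.chart (f^[tba] z) = Tba.toFun (chartB.chart z)
  Tab_eq : ∀ᶠ z in 𝓝 Ym, f^[tab] z ∈ chartB.chart.source ∧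
    chartB.chart (f^[tab] z) = Tab.toFun (chartA.chart z)
  /-- The central part of the transition along the quasi-transverse orbit is linear. -/
  Tab_central_linear : Tab.Tc 0 = 0
  /-- The neighbourhood of the cycle. -/
  V₀ : Set M
  isOpen_V₀ : IsOpen V₀
  subset_V₀ : fullOrbit f A ∪ fullOrbit f B ∪ fullOrbit f Xm ∪ fullOrbit f Ym ⊆ V₀

namespace SimpleCycle

variable {f : Diffeomorph (𝓡 (s + 1 + u)) (𝓡 (s + 1 + u)) M M 1} (C : SimpleCycle s u f)

/-- The union of the four orbits of the cycle. -/
def orbits : Set M :=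
  fullOrbit f C.A ∪ fullOrbit f C.B ∪ fullOrbit f C.Xm ∪ fullOrbit f C.Ym

/-- The point `Y⁺`. -/
def Yp : M := f^[C.tab] C.Ym

end SimpleCycle

/-- The unfolding of a simple cycle: a family `map ν` of `C¹` diffeomorphisms, `|ν| < ν₀`, through
`map 0 = f`, converging to `f` in the `C¹` topology as `ν → 0`, obtained by perturbing `f` in a
vicinity `W` of `Y⁺` only, and such that the transition from `A` to `B` becomes, in the local
coordinates, the original one plus `(0, ν, 0)`. -/
structure Unfolding [IsManifold (𝓡 (s + 1 + u)) 1 M]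
    {f : Diffeomorph (𝓡 (s + 1 + u)) (𝓡 (s + 1 + u)) M M 1} (C : SimpleCycle s u f) where
  ν₀ : ℝ
  ν₀_pos : 0 < ν₀
  map : ℝ → Diffeomorph (𝓡 (s + 1 + u)) (𝓡 (s + 1 + u)) M M 1
  map_zero : map 0 = f
  tendsto_C1 : ∀ v : TangentBundle (𝓡 (s + 1 + u)) M,
    ContinuousAt (fun q : ℝ × TangentBundle (𝓡 (s + 1 + u)) M =>
      tangentMap (𝓡 (s + 1 + u)) (𝓡 (s + 1 + u)) (map q.1) q.2) (0, v)
  W : Set M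
  isClosed_W : IsClosed W
  W_mem_nhds : W ∈ 𝓝 C.Yp
  /-- The vicinity contains no other point of the orbits of the cycle. -/
  W_inter_orbits : W ∩ C.orbits = {C.Yp}
  eq_off : ∀ ν : ℝ, |ν| < ν₀ → ∀ z : M, f z ∉ W → map ν z = f z
  transition : ∀ᶠ z in 𝓝 C.Ym, ∀ ν : ℝ, |ν| < ν₀ →
    (map ν)^[C.tab] z ∈ C.chartB.chart.source ∧
    C.chartB.chart ((map ν)^[C.tab] z) = C.chartB.chart (f^[C.tab] z) + (0, ν, 0)

end Cycle

end HeteroCycle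

end

/-! In the linearizing charts every piece of the cycle is a block map `(s, c, u)`. The itinerary
"transition `B → A`, `l` returns near `A`, perturbed transition `A → B`, `m` returns near `B`"
therefore composes formally to a product of three affine maps, and each factor can be given a fixed
point separately. The strong stable part has linear part tending to `0`, so it has a unique fixed
point for large `(l, m)`. The same holds for the inverse of the strong unstable part. In the central
direction, `c` is fixed by solving one scalar equation for `ν`, and `|λ_A| < 1 < |λ_B|` forces `ν →
0`.

It remains to realize this formal fixed point by a true orbit of `f_ν`. Long passages near a saddle
shadow the local pieces of the cycle (`HyperbolicSplitting.shadowing`, `exists_segments`). These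
pieces form a compact set inside an open set where the return map stays in the chart, in `V` and off
the support `W` of the perturbation. The two transitions are valid on neighborhoods of `X⁻` and
`Y⁻`. `exists_periodic_orbits` glues the four segments.

The least period comes from choosing `V` to contain all orbits of the cycle except `X⁻`, and to miss
a neighborhood of `X⁻` (`exists_open_superset`): the intermediate iterates of `R` lie in `V`, while
`R` does not.

The derivative of the return map is block diagonal. Its central entry is `± λ_B^m λ_A^l`. Gelfand's
formula bounds the eigenvalues of the stable block by `|λ_A|^l` from above and those of the unstable
block by `|λ_B|^m` from below (`eventually_isCentralMultiplier`). This gives the domination, and the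
index follows by counting. -/

namespace HeteroCycle

/-! ### Eigenvalues of real endomorphisms, decay of powers, and fixed points of affine contractions.
-/

section LinearAlgebra

variable {E : Type*} [NormedAddCommGroup E]

theorem mem_eigenvalues [Module ℝ E] [Module.Finite ℝ E] {L : E →ₗ[ℝ] E} {z : ℂ} :
    z ∈ eigenvalues L ↔ (L.charpoly.map (algebraMap ℝ ℂ)).IsRoot z :=
  Polynomial.mem_roots (L.charpoly_monic.map _).ne_zero

theorem card_eigenvalues [Module ℝ E] [Module.Finite ℝ E] (L : E →ₗ[ℝ] E) :
    Multiset.card (eigenvalues L) = Module.finrank ℝ E := by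
  rw [eigenvalues, IsAlgClosed.card_roots_eq_natDegree, Polynomial.natDegree_map,
    LinearMap.charpoly_natDegree]

theorem eigenvalues_prodMap {F : Type*} [NormedAddCommGroup F] [Module ℝ F] [Module.Finite ℝ F]
    [Module ℝ E] [Module.Finite ℝ E] (L : E →ₗ[ℝ] E) (L' : F →ₗ[ℝ] F) :
    eigenvalues (L.prodMap L') = eigenvalues L + eigenvalues L' := by
  rw [eigenvalues, LinearMap.charpoly_prodMap, Polynomial.map_mul, Polynomial.roots_mul]
  · rfl
  · exact mul_ne_zero (L.charpoly_monic.map _).ne_zero (L'.charpoly_monic.map _).ne_zero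

theorem eigenvalues_smul_id (c : ℝ) :
    eigenvalues (c • (LinearMap.id : ℝ →ₗ[ℝ] ℝ)) = {(c : ℂ)} := by
  have h : (c • (LinearMap.id : ℝ →ₗ[ℝ] ℝ)).charpoly = Polynomial.X - Polynomial.C c := by
    rw [← LinearMap.charpoly_toMatrix _ (Module.Basis.singleton Unit ℝ), Matrix.charpoly,
      Matrix.det_unique, Matrix.charmatrix_apply, LinearMap.toMatrix_apply]
    simp
  rw [eigenvalues, h]
  simp

theorem eigenvalues_conj {F : Type*} [NormedAddCommGroup F] [Module ℝ F] [Module.Finite ℝ F]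
    [Module ℝ E] [Module.Finite ℝ E] (e : E ≃ₗ[ℝ] F) (L : E →ₗ[ℝ] E) (L' : F →ₗ[ℝ] F)
    (h : ∀ x, e (L x) = L' (e x)) : eigenvalues L = eigenvalues L' := by
  have : L' = e.conj L := by
    ext x
    simp [LinearEquiv.conj_apply, h]
  rw [eigenvalues, eigenvalues, this, LinearEquiv.charpoly_conj]

/-- The complex matrix of a real endomorphism. -/
noncomputable def complexMatrix [NormedSpace ℝ E] [FiniteDimensional ℝ E] :
    (E →L[ℝ] E) →ₗ[ℝ]
      Matrix (Fin (Module.finrank ℝ E)) (Fin (Module.finrank ℝ E)) ℂ where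
  toFun L := (LinearMap.toMatrix (Module.finBasis ℝ E) (Module.finBasis ℝ E)
    (L : E →ₗ[ℝ] E)).map (algebraMap ℝ ℂ)
  map_add' L L' := by ext; simp
  map_smul' c L := by ext; simp

variable [NormedSpace ℝ E] [FiniteDimensional ℝ E]

theorem complexMatrix_mul (L L' : E →L[ℝ] E) :
    complexMatrix (L * L') = complexMatrix L * complexMatrix L' := by
  have : ((L * L' : E →L[ℝ] E) : E →ₗ[ℝ] E) = (L : E →ₗ[ℝ] E) ∘ₗ (L' : E →ₗ[ℝ] E) := rfl
  simp only [complexMatrix, LinearMap.coe_mk, AddHom.coe_mk, this,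
    LinearMap.toMatrix_comp _ (Module.finBasis ℝ E), Matrix.map_mul]

theorem complexMatrix_one : complexMatrix (1 : E →L[ℝ] E) = 1 := by
  have : ((1 : E →L[ℝ] E) : E →ₗ[ℝ] E) = LinearMap.id := rfl
  simp only [complexMatrix, LinearMap.coe_mk, AddHom.coe_mk, this, LinearMap.toMatrix_id]
  simp

theorem complexMatrix_pow (L : E →L[ℝ] E) (k : ℕ) :
    complexMatrix (L ^ k) = complexMatrix L ^ k := by
  induction k with
  | zero => simp [complexMatrix_one]
  | succ k ih => rw [pow_succ, pow_succ, complexMatrix_mul, ih]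

theorem complexMatrix_injective : Injective (complexMatrix (E := E)) := by
  intro L L' h
  have h1 : LinearMap.toMatrix (Module.finBasis ℝ E) (Module.finBasis ℝ E) (L : E →ₗ[ℝ] E) =
      LinearMap.toMatrix (Module.finBasis ℝ E) (Module.finBasis ℝ E) (L' : E →ₗ[ℝ] E) :=
    Matrix.map_injective (algebraMap ℝ ℂ).injective h
  exact ContinuousLinearMap.coe_injective ((LinearMap.toMatrix _ _).injective h1)

theorem charpoly_complexMatrix (L : E →L[ℝ] E) :
    (complexMatrix L).charpoly = (L : E →ₗ[ℝ] E).charpoly.map (algebraMap ℝ ℂ) := by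
  rw [← LinearMap.charpoly_toMatrix _ (Module.finBasis ℝ E), ← Matrix.charpoly_map]
  rfl

theorem mem_eigenvalues_iff_mem_spectrum (L : E →L[ℝ] E) (z : ℂ) :
    z ∈ eigenvalues (L : E →ₗ[ℝ] E) ↔ z ∈ spectrum ℂ (complexMatrix L) := by
  rw [Matrix.mem_spectrum_iff_isRoot_charpoly, charpoly_complexMatrix, mem_eigenvalues]

/-- The vectors `a` and `b` are the real and imaginary parts of a complex eigenvector of
`complexMatrix L`. This keeps eigenvalue estimates inside the real space `E`. -/
theorem exists_eigenpair {L : E →L[ℝ] E} {z : ℂ} (hz : z ∈ eigenvalues (L : E →ₗ[ℝ] E)) :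
    ∃ a b : E, (a ≠ 0 ∨ b ≠ 0) ∧ L a = z.re • a - z.im • b ∧ L b = z.im • a + z.re • b := by
  have hz' : (Matrix.toLin' (complexMatrix L)).charpoly.IsRoot z := by
    rw [Matrix.charpoly_toLin', charpoly_complexMatrix]
    exact mem_eigenvalues.1 hz
  obtain ⟨v, hv⟩ := (Module.End.hasEigenvalue_iff_isRoot_charpoly _ _).2 hz' |>.exists_hasEigenvector
  have hv1 : (complexMatrix L).mulVec v = z • v := by simpa using hv.apply_eq_smul
  set B := Module.finBasis ℝ E
  have key : ∀ x : Fin (Module.finrank ℝ E) → ℝ, ∀ i,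
      B.repr (L (B.equivFun.symm x)) i =
        (LinearMap.toMatrix B B (L : E →ₗ[ℝ] E)).mulVec x i := by
    intro x i
    have h := LinearMap.toMatrix_mulVec_repr B B (L : E →ₗ[ℝ] E) (B.equivFun.symm x)
    have h2 : ⇑(B.repr (B.equivFun.symm x)) = x := by
      have := B.equivFun.apply_symm_apply x
      rwa [Module.Basis.equivFun_apply] at this
    rw [h2] at h
    exact (congrFun h i).symm
  have hrepr : ∀ x i, B.repr (B.equivFun.symm x) i = x i := fun x i => by
    have := congrFun (B.equivFun.apply_symm_apply x) i
    rwa [Module.Basis.equivFun_apply] at this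
  have hre : ∀ i, (LinearMap.toMatrix B B (L : E →ₗ[ℝ] E)).mulVec (fun j => (v j).re) i =
      z.re * (v i).re - z.im * (v i).im := by
    intro i
    have := congrArg Complex.re (congrFun hv1 i)
    simpa [Matrix.mulVec, dotProduct, complexMatrix, B] using this
  have him : ∀ i, (LinearMap.toMatrix B B (L : E →ₗ[ℝ] E)).mulVec (fun j => (v j).im) i =
      z.im * (v i).re + z.re * (v i).im := by
    intro i
    have := congrArg Complex.im (congrFun hv1 i)
    have h3 : (z • v) i = z * v i := rfl
    rw [h3, Complex.mul_im] at this
    rw [add_comm, ← this]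
    simp [Matrix.mulVec, dotProduct, complexMatrix, B]
  refine ⟨B.equivFun.symm fun j => (v j).re, B.equivFun.symm fun j => (v j).im, ?_, ?_, ?_⟩
  · by_contra! h
    apply hv.2
    ext i
    have h1 := congrArg (fun x => B.repr x i) h.1
    have h2 := congrArg (fun x => B.repr x i) h.2
    simp only [hrepr] at h1 h2
    exact Complex.ext (by simpa using h1) (by simpa using h2)
  · apply B.repr.injective
    ext i
    rw [map_sub, map_smul, map_smul, Finsupp.sub_apply, Finsupp.smul_apply, Finsupp.smul_apply,
      key, hre, hrepr, hrepr, smul_eq_mul, smul_eq_mul]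
  · apply B.repr.injective
    ext i
    rw [map_add, map_smul, map_smul, Finsupp.add_apply, Finsupp.smul_apply, Finsupp.smul_apply,
      key, him, hrepr, hrepr, smul_eq_mul, smul_eq_mul]

/-- Multiplication by `x + iy` scales the Hermitian norm on the complexification `a + ib`; the two
cross terms in `⟪a, b⟫` cancel. -/
theorem norm_sq_eigenpair {E : Type*} [NormedAddCommGroup E] [InnerProductSpace ℝ E]
    (x y : ℝ) (a b : E) :
    ‖x • a - y • b‖ ^ 2 + ‖y • a + x • b‖ ^ 2 = (x ^ 2 + y ^ 2) * (‖a‖ ^ 2 + ‖b‖ ^ 2) := by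
  rw [norm_sub_sq_real, norm_add_sq_real]
  simp only [norm_smul, inner_smul_left, inner_smul_right, mul_pow, Real.norm_eq_abs, sq_abs]
  simp
  ring

theorem eigenvalue_bound {E : Type*} [NormedAddCommGroup E] [InnerProductSpace ℝ E]
    [FiniteDimensional ℝ E] {L : E →L[ℝ] E} {z : ℂ} (hz : z ∈ eigenvalues (L : E →ₗ[ℝ] E)) :
    ∃ p q α β : ℝ, 0 < p ^ 2 + q ^ 2 ∧ α ^ 2 + β ^ 2 = ‖z‖ ^ 2 * (p ^ 2 + q ^ 2) ∧
      ∃ a b : E, ‖a‖ = p ∧ ‖b‖ = q ∧ ‖L a‖ = α ∧ ‖L b‖ = β := by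
  obtain ⟨a, b, h0, ha, hb⟩ := exists_eigenpair hz
  refine ⟨‖a‖, ‖b‖, ‖L a‖, ‖L b‖, ?_, ?_, a, b, rfl, rfl, rfl, rfl⟩
  · rcases h0 with h | h
    · have := norm_pos_iff.2 h
      positivity
    · have := norm_pos_iff.2 h
      positivity
  · rw [ha, hb, norm_sq_eigenpair, Complex.sq_norm, Complex.normSq_apply]
    ring

theorem norm_le_of_mem_eigenvalues {E : Type*} [NormedAddCommGroup E] [InnerProductSpace ℝ E]
    [FiniteDimensional ℝ E] {L : E →L[ℝ] E} {z : ℂ} (hz : z ∈ eigenvalues (L : E →ₗ[ℝ] E)) :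
    ‖z‖ ≤ ‖L‖ := by
  obtain ⟨p, q, α, β, hpq, h, a, b, rfl, rfl, rfl, rfl⟩ := eigenvalue_bound hz
  have h1 : ‖L a‖ ^ 2 ≤ ‖L‖ ^ 2 * ‖a‖ ^ 2 := by
    rw [← mul_pow]; exact pow_le_pow_left₀ (norm_nonneg _) (L.le_opNorm a) 2
  have h2 : ‖L b‖ ^ 2 ≤ ‖L‖ ^ 2 * ‖b‖ ^ 2 := by
    rw [← mul_pow]; exact pow_le_pow_left₀ (norm_nonneg _) (L.le_opNorm b) 2
  have h3 : ‖z‖ ^ 2 ≤ ‖L‖ ^ 2 := by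
    refine le_of_mul_le_mul_right ?_ hpq
    rw [← h, mul_add]; exact add_le_add h1 h2
  exact (pow_le_pow_iff_left₀ (norm_nonneg _) (norm_nonneg _) two_ne_zero).1 h3

theorem one_le_of_mem_eigenvalues {E : Type*} [NormedAddCommGroup E] [InnerProductSpace ℝ E]
    [FiniteDimensional ℝ E] {L L' : E →L[ℝ] E} (hL : ∀ v, L' (L v) = v) {z : ℂ}
    (hz : z ∈ eigenvalues (L : E →ₗ[ℝ] E)) : 1 ≤ ‖L'‖ * ‖z‖ := by
  obtain ⟨p, q, α, β, hpq, h, a, b, rfl, rfl, rfl, rfl⟩ := eigenvalue_bound hz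
  have h0 : ∀ v, ‖v‖ ^ 2 ≤ ‖L'‖ ^ 2 * ‖L v‖ ^ 2 := fun v => by
    rw [← mul_pow]
    refine pow_le_pow_left₀ (norm_nonneg _) ?_ 2
    simpa [hL] using L'.le_opNorm (L v)
  have h3 : (1 : ℝ) ^ 2 ≤ (‖L'‖ * ‖z‖) ^ 2 := by
    refine le_of_mul_le_mul_right ?_ hpq
    rw [mul_pow, mul_assoc, ← h, one_pow, one_mul, mul_add]
    exact add_le_add (h0 a) (h0 b)
  exact (pow_le_pow_iff_left₀ zero_le_one (by positivity) two_ne_zero).1 h3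

section Gelfand

attribute [local instance] Matrix.linftyOpNormedRing Matrix.linftyOpNormedAlgebra

/-- Gelfand's formula for the complex matrix of `L`, with some `q` strictly between the spectral
radius and `r`, gives `‖A ^ k‖ ≤ q ^ k` eventually. The limit is carried back to `E →L[ℝ] E` because
an injective linear map of finite-dimensional spaces is a closed embedding. -/
theorem tendsto_pow_of_eigenvalues_lt {L : E →L[ℝ] E} {r : ℝ} (hr : 0 < r)
    (h : ∀ z ∈ eigenvalues (L : E →ₗ[ℝ] E), ‖z‖ < r) :
    Tendsto (fun k : ℕ => (r⁻¹ • L) ^ k) atTop (𝓝 0) := by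
  rcases subsingleton_or_nontrivial E with hE | hE
  · have : ∀ k : ℕ, (r⁻¹ • L) ^ k = 0 := fun k => by ext x; exact Subsingleton.elim _ _
    simp [this]
  have hne : Nonempty (Fin (Module.finrank ℝ E)) := Fin.pos_iff_nonempty.1 Module.finrank_pos
  set A := complexMatrix L with hA
  have hρ : spectralRadius ℂ A < (r.toNNReal : NNReal) := by
    refine spectrum.spectralRadius_lt_of_forall_lt A fun z hz => ?_
    rw [← NNReal.coe_lt_coe, Real.coe_toNNReal _ hr.le]
    exact h z ((mem_eigenvalues_iff_mem_spectrum L z).2 hz)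
  obtain ⟨q, hq1, hq2⟩ := ENNReal.lt_iff_exists_nnreal_btwn.1 hρ
  have hq2 : (q : ℝ) < r := by
    have := ENNReal.coe_lt_coe.1 hq2
    rwa [← NNReal.coe_lt_coe, Real.coe_toNNReal _ hr.le] at this
  have hev := (spectrum.pow_nnnorm_pow_one_div_tendsto_nhds_spectralRadius A).eventually_lt_const hq1
  have hbd : ∀ᶠ k : ℕ in atTop, ‖A ^ k‖ ≤ (q : ℝ) ^ k := by
    filter_upwards [hev, eventually_gt_atTop 0] with k hk hk0
    have h1 : (‖A ^ k‖₊ : ENNReal) ≤ (q : ENNReal) ^ k := by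
      have := ENNReal.rpow_le_rpow hk.le (z := k) (by positivity)
      rwa [← ENNReal.rpow_mul, one_div, inv_mul_cancel₀ (by positivity), ENNReal.rpow_one,
        ENNReal.rpow_natCast] at this
    exact_mod_cast h1
  have hemb : Topology.IsClosedEmbedding (complexMatrix (E := E)) :=
    LinearMap.isClosedEmbedding_of_injective (LinearMap.ker_eq_bot.2 complexMatrix_injective)
  rw [hemb.isInducing.tendsto_nhds_iff, map_zero]
  have h0 : Tendsto (fun k : ℕ => ((q : ℝ) / r) ^ k) atTop (𝓝 0) :=
    tendsto_pow_atTop_nhds_zero_of_lt_one (by positivity) ((div_lt_one hr).2 hq2)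
  refine squeeze_zero_norm' ?_ h0
  filter_upwards [hbd] with k hk
  have : complexMatrix ((r⁻¹ • L) ^ k) = ((r⁻¹) ^ k : ℝ) • A ^ k := by
    rw [smul_pow, map_smul, complexMatrix_pow]
  simp only [Function.comp_apply, this]
  have hns : ‖((r⁻¹) ^ k : ℝ) • A ^ k‖ ≤ ‖((r⁻¹) ^ k : ℝ)‖ * ‖A ^ k‖ := norm_smul_le _ _
  refine hns.trans ?_
  rw [Real.norm_of_nonneg (by positivity), div_pow, inv_pow, div_eq_inv_mul]
  gcongr

end Gelfand

theorem exists_inverse_of_lt_eigenvalues {L : E →L[ℝ] E} {r : ℝ} (hr : 0 ≤ r)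
    (h : ∀ z ∈ eigenvalues (L : E →ₗ[ℝ] E), r < ‖z‖) :
    ∃ L' : E →L[ℝ] E, (∀ x, L (L' x) = x) ∧ (∀ x, L' (L x) = x) := by
  have hinj : Injective (L : E →ₗ[ℝ] E) := by
    rw [← LinearMap.ker_eq_bot]
    by_contra hker
    have h1 : Module.End.HasEigenvalue (L : E →ₗ[ℝ] E) 0 := by
      rw [Module.End.hasEigenvalue_iff, Module.End.eigenspace_zero]
      exact hker
    have h2 := (Module.End.hasEigenvalue_iff_isRoot_charpoly _ _).1 h1
    have h3 : (0 : ℂ) ∈ eigenvalues (L : E →ₗ[ℝ] E) := by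
      rw [mem_eigenvalues]
      simpa using h2.map (f := algebraMap ℝ ℂ)
    have := h 0 h3
    simp at this
    linarith
  let e := LinearEquiv.ofInjectiveEndo (L : E →ₗ[ℝ] E) hinj
  refine ⟨LinearMap.toContinuousLinearMap (e.symm : E →ₗ[ℝ] E), fun x => ?_, fun x => ?_⟩
  · exact e.apply_symm_apply x
  · exact e.symm_apply_apply x

/-- The spectrum of the inverse is the inverse of the spectrum, so the eigenvalues of `L'` have
modulus below `r⁻¹`. -/
theorem tendsto_inverse_pow_of_lt_eigenvalues {L L' : E →L[ℝ] E} {r : ℝ} (hr : 0 < r)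
    (h1 : ∀ x, L (L' x) = x) (h2 : ∀ x, L' (L x) = x)
    (h : ∀ z ∈ eigenvalues (L : E →ₗ[ℝ] E), r < ‖z‖) :
    Tendsto (fun k : ℕ => (r • L') ^ k) atTop (𝓝 0) := by
  have := tendsto_pow_of_eigenvalues_lt (L := L') (inv_pos.2 hr) ?_
  · simpa using this
  intro z hz
  have m1 : complexMatrix L * complexMatrix L' = 1 := by
    rw [← complexMatrix_mul, ← complexMatrix_one]; congr 1; ext x; exact h1 x
  have m2 : complexMatrix L' * complexMatrix L = 1 := by
    rw [← complexMatrix_mul, ← complexMatrix_one]; congr 1; ext x; exact h2 x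
  let U : (Matrix (Fin (Module.finrank ℝ E)) (Fin (Module.finrank ℝ E)) ℂ)ˣ :=
    ⟨complexMatrix L, complexMatrix L', m1, m2⟩
  have hz' : z ∈ (spectrum ℂ U.val)⁻¹ := by
    rw [spectrum.map_inv]
    exact (mem_eigenvalues_iff_mem_spectrum L' z).1 hz
  have := h z⁻¹ ((mem_eigenvalues_iff_mem_spectrum L _).2 hz')
  rw [norm_inv] at this
  -- With `z = 0` the convention `0⁻¹ = 0` would turn the bound on `z⁻¹` into `r < 0`.
  exact (lt_inv_comm₀ hr (by
    by_contra h0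
    have : ‖z‖ = 0 := le_antisymm (not_lt.1 h0) (norm_nonneg _)
    simp_all; linarith)).1 this

theorem tendsto_clm_apply {E F ι : Type*} [NormedAddCommGroup E] [NormedSpace ℝ E]
    [NormedAddCommGroup F] [NormedSpace ℝ F] {l : Filter ι}
    {T : ι → E →L[ℝ] F} {T₀ : E →L[ℝ] F} {x : ι → E} {x₀ : E} (hT : Tendsto T l (𝓝 T₀))
    (hx : Tendsto x l (𝓝 x₀)) : Tendsto (fun i => T i (x i)) l (𝓝 (T₀ x₀)) :=
  (isBoundedBilinearMap_apply.continuous.tendsto (T₀, x₀)).comp (hT.prodMk_nhds hx)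

theorem tendsto_fst_atTop : Tendsto (Prod.fst : ℕ × ℕ → ℕ) atTop atTop := by
  rw [← prod_atTop_atTop_eq]; exact tendsto_fst

theorem tendsto_snd_atTop : Tendsto (Prod.snd : ℕ × ℕ → ℕ) atTop atTop := by
  rw [← prod_atTop_atTop_eq]; exact tendsto_snd

/-- A family of affine contractions whose linear parts tend to `0`. -/
theorem exists_fixedPoints_tendsto {ι : Type*} {l : Filter ι} {N : ι → E →L[ℝ] E} {b : ι → E}
    {b₀ : E} (hN : Tendsto N l (𝓝 0)) (hb : Tendsto b l (𝓝 b₀)) :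
    ∃ y : ι → E, Tendsto y l (𝓝 b₀) ∧ ∀ᶠ i in l, y i = N i (y i) + b i := by
  have : CompleteSpace E := FiniteDimensional.complete ℝ E
  have h1 : Tendsto (fun i => 1 - N i) l (𝓝 (1 : E →L[ℝ] E)) := by
    simpa using tendsto_const_nhds.sub hN
  -- The fixed point is `(1 - N)⁻¹ b`. `Ring.inverse` has the junk value `0` at non-units, but `1 -
  -- N i` tends to `1` and units form a neighborhood of `1`, so this only matters outside an
  -- eventual set.
  refine ⟨fun i => Ring.inverse (1 - N i) (b i), ?_, ?_⟩
  · have h2 : Tendsto (fun i => Ring.inverse (1 - N i)) l (𝓝 (1 : E →L[ℝ] E)) := by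
      have := (NormedRing.inverse_continuousAt (1 : (E →L[ℝ] E)ˣ)).tendsto
      simp only [Units.val_one, Ring.inverse_one] at this
      exact this.comp h1
    simpa using tendsto_clm_apply h2 hb
  · have h3 : ∀ᶠ i in l, IsUnit (1 - N i) := h1.eventually ((1 : (E →L[ℝ] E)ˣ).nhds)
    filter_upwards [h3] with i hi
    have := congrArg (fun T : E →L[ℝ] E => T (b i)) (Ring.mul_inverse_cancel _ hi)
    exact sub_eq_iff_eq_add'.1 this

/-- Serves both strong directions: with the forward maps for the stable one, with the inverse maps
for the unstable one. The limit is `T₁ 0` because the argument of `T₁` is pushed to `0` by `a ^ l`.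
-/
theorem exists_fixedPoints_affine {a b : E →L[ℝ] E} (T₁ T₂ : E →ᵃ[ℝ] E)
    (ha : Tendsto (fun k : ℕ => a ^ k) atTop (𝓝 0))
    (hb : Tendsto (fun k : ℕ => b ^ k) atTop (𝓝 0)) :
    ∃ y : ℕ × ℕ → E, Tendsto y atTop (𝓝 (T₁ 0)) ∧
      ∀ᶠ i in atTop, y i = T₁ ((a ^ i.1) (T₂ ((b ^ i.2) (y i)))) := by
  have ha' : Tendsto (fun i : ℕ × ℕ => a ^ i.1) atTop (𝓝 0) := ha.comp tendsto_fst_atTop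
  have hb' : Tendsto (fun i : ℕ × ℕ => b ^ i.2) atTop (𝓝 0) := hb.comp tendsto_snd_atTop
  let t₁ : E →L[ℝ] E := LinearMap.toContinuousLinearMap T₁.linear
  let t₂ : E →L[ℝ] E := LinearMap.toContinuousLinearMap T₂.linear
  have e₁ : ∀ x, T₁ x = t₁ x + T₁ 0 := fun x => by
    have h : T₁ x = T₁.linear x + T₁ 0 := by simpa using T₁.map_vadd 0 x
    exact h
  have e₂ : ∀ x, T₂ x = t₂ x + T₂ 0 := fun x => by
    have h : T₂ x = T₂.linear x + T₂ 0 := by simpa using T₂.map_vadd 0 x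
    exact h
  obtain ⟨y, hy, hfix⟩ := exists_fixedPoints_tendsto (l := (atTop : Filter (ℕ × ℕ)))
    (N := fun i => t₁ * a ^ i.1 * t₂ * b ^ i.2) (b := fun i => t₁ ((a ^ i.1) (T₂ 0)) + T₁ 0)
    (b₀ := T₁ 0) (by
      have := ((tendsto_const_nhds (x := t₁)).mul ha').mul (tendsto_const_nhds (x := t₂)) |>.mul hb'
      simpa using this) (by
      have h1 : Tendsto (fun i : ℕ × ℕ => t₁ ((a ^ i.1) (T₂ 0))) atTop (𝓝 0) := by
        have := (t₁.continuous.tendsto 0).comp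
          (by simpa using tendsto_clm_apply ha' (tendsto_const_nhds (x := T₂ 0)))
        simpa [Function.comp_def] using this
      simpa using h1.add_const (T₁ 0))
  refine ⟨y, hy, hfix.mono fun i hi => ?_⟩
  rw [e₁, e₂, map_add, map_add, add_assoc]
  exact hi

end LinearAlgebra

end HeteroCycle

namespace HeteroCycle

/-! ### Hyperbolic splittings of a linear saddle and shadowing of long passages. -/

section Splitting

/-- A hyperbolic splitting for `L`: `P k` is `L ^ k` on the stable subspace (and `0` on the unstable
one), `Q k` is `L ^ (-k)` on the unstable subspace. -/
structure HyperbolicSplitting {E : Type*} [NormedAddCommGroup E] [NormedSpace ℝ E]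
    (L : E →L[ℝ] E) where
  P : ℕ → E →L[ℝ] E
  Q : ℕ → E →L[ℝ] E
  tendsto_P : Tendsto P atTop (𝓝 0)
  tendsto_Q : Tendsto Q atTop (𝓝 0)
  P_add_Q : ∀ x, P 0 x + Q 0 x = x
  map_P : ∀ k x, L (P k x) = P (k + 1) x
  P_map : ∀ k x, P k (L x) = P (k + 1) x
  map_Q : ∀ k x, L (Q (k + 1) x) = Q k x
  Q_map : ∀ k x, Q (k + 1) (L x) = Q k x

namespace HyperbolicSplitting

variable {E : Type*} [NormedAddCommGroup E] [NormedSpace ℝ E] {L : E →L[ℝ] E}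
  (S : HyperbolicSplitting L)

theorem pow_P (k : ℕ) (x : E) : (L ^ k) (S.P 0 x) = S.P k x := by
  induction k with
  | zero => simp
  | succ k ih => rw [pow_succ', mul_apply_eq_comp, ih, S.map_P]

theorem P_pow (k : ℕ) (x : E) : S.P 0 ((L ^ k) x) = S.P k x := by
  induction k generalizing x with
  | zero => simp
  | succ k ih => rw [pow_succ, mul_apply_eq_comp, ih, S.P_map]

theorem pow_Q (j k : ℕ) (x : E) : (L ^ k) (S.Q (j + k) x) = S.Q j x := by
  induction k with
  | zero => simp
  | succ k ih => rw [pow_succ, mul_apply_eq_comp, ← add_assoc, S.map_Q, ih]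

theorem Q_pow (k : ℕ) (x : E) : S.Q k ((L ^ k) x) = S.Q 0 x := by
  induction k with
  | zero => simp
  | succ k ih => rw [pow_succ', mul_apply_eq_comp, S.Q_map, ih]

/-- `Q_k L^k x` is constantly `Q_0 x`, while both `Q_k` and `L^k x` tend to `0`. -/
theorem Q_eq_zero_of_tendsto {x : E} (h : Tendsto (fun k => (L ^ k) x) atTop (𝓝 0)) :
    S.Q 0 x = 0 := by
  have h1 := tendsto_clm_apply S.tendsto_Q h
  simp only [S.Q_pow, zero_apply] at h1
  exact tendsto_nhds_unique tendsto_const_nhds h1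

/-- `w` is a backward orbit of `x`, so `P_k (w k)` is constantly `P_0 x`. This applies where `L`
need not be invertible, since the stable block may be singular. -/
theorem P_eq_zero_of_tendsto {x : E} {w : ℕ → E} (hw : ∀ k, (L ^ k) (w k) = x)
    (h : Tendsto w atTop (𝓝 0)) : S.P 0 x = 0 := by
  have h1 := tendsto_clm_apply S.tendsto_P h
  have h2 : ∀ k, S.P k (w k) = S.P 0 x := fun k => by rw [← hw k, S.P_pow]
  simp only [h2, zero_apply] at h1
  exact tendsto_nhds_unique tendsto_const_nhds h1

theorem pow_eq_P {x : E} (h : S.Q 0 x = 0) (k : ℕ) : (L ^ k) x = S.P k x := by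
  have := S.P_add_Q x
  rw [h, add_zero] at this
  rw [← S.pow_P, this]

theorem eq_Q {x w : E} {k : ℕ} (h : (L ^ k) w = x) (hw : S.P 0 w = 0) : w = S.Q k x := by
  have := S.P_add_Q w
  rw [hw, zero_add] at this
  rw [← h, S.Q_pow, this]

theorem P_eq_of_Q {x : E} (h : S.Q 0 x = 0) : S.P 0 x = x := by
  have := S.P_add_Q x
  rwa [h, add_zero] at this

theorem Q_eq_of_P {x : E} (h : S.P 0 x = 0) : S.Q 0 x = x := by
  have := S.P_add_Q x
  rwa [h, zero_add] at this

/-- A passage is prescribed by its stable part `p` at entry and its unstable part `q` at exit. Then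
only the bounded families `P` and `Q` enter the formula at intermediate times. -/
theorem pow_add {l k : ℕ} (hk : k ≤ l) (p q : E) :
    (L ^ k) (S.P 0 p + S.Q l q) = S.P k p + S.Q (l - k) q := by
  obtain ⟨j, rfl⟩ := Nat.exists_eq_add_of_le' hk
  rw [map_add, S.pow_P, S.pow_Q, Nat.add_sub_cancel]

/-- The orbits going from near the stable point `x` to near the unstable point `y` in `l` steps
shadow the orbits of `x` and `y`. -/
theorem shadowing (x y : E) {ε : ℝ} (hε : 0 < ε) :
    ∃ δ > 0, ∃ N, ∀ l ≥ N, ∀ p q, dist p x < δ → dist q y < δ → ∀ k ≤ l,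
      dist (S.P k p + S.Q (l - k) q) (S.P k x) < ε ∨
      dist (S.P k p + S.Q (l - k) q) (S.Q (l - k) y) < ε := by
  obtain ⟨C, hC⟩ := (Metric.isBounded_range_of_tendsto _ S.tendsto_P.norm).exists_norm_le
  obtain ⟨D, hD⟩ := (Metric.isBounded_range_of_tendsto _ S.tendsto_Q.norm).exists_norm_le
  have hC' : ∀ k, ‖S.P k‖ ≤ C := fun k => by simpa using hC _ ⟨k, rfl⟩
  have hD' : ∀ k, ‖S.Q k‖ ≤ D := fun k => by simpa using hD _ ⟨k, rfl⟩
  have hC0 : 0 ≤ C := (norm_nonneg _).trans (hC' 0)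
  have hD0 : 0 ≤ D := (norm_nonneg _).trans (hD' 0)
  set δ := min 1 (ε / (2 * (C + D + 1)))
  have hδ : 0 < δ := by positivity
  have hδε : (C + D + 1) * δ ≤ ε / 2 := by
    calc (C + D + 1) * δ ≤ (C + D + 1) * (ε / (2 * (C + D + 1))) := by
          gcongr; exact min_le_right _ _
      _ = ε / 2 := by field_simp
  set η := ε / (2 * (‖x‖ + ‖y‖ + 1))
  have hη : 0 < η := by positivity
  have hηε : η * (‖x‖ + ‖y‖ + 1) = ε / 2 := by simp only [η]; field_simp
  obtain ⟨N, hN⟩ := eventually_atTop.1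
    ((S.tendsto_P.norm.eventually_lt_const (by simpa using hη)).and
      (S.tendsto_Q.norm.eventually_lt_const (by simpa using hη)))
  -- With `l ≥ 2N`, either `k ≥ N` and the stable term is negligible, or `l - k ≥ N` and the
  -- unstable term is.
  refine ⟨δ, hδ, 2 * N, fun l hl p q hp hq k hk => ?_⟩
  have bound : ∀ (T : E →L[ℝ] E) (z w : E), dist z w < δ → ‖T‖ < η → ‖w‖ ≤ ‖x‖ + ‖y‖ →
      ‖T z‖ < ε / 2 := fun T z w hz hT hw => by
    have : ‖z‖ ≤ ‖x‖ + ‖y‖ + 1 := by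
      have h1 : ‖z‖ ≤ dist z w + ‖w‖ := by
        rw [dist_eq_norm]; simpa using norm_add_le (z - w) w
      have h2 : δ ≤ 1 := min_le_left _ _
      linarith
    calc ‖T z‖ ≤ ‖T‖ * ‖z‖ := T.le_opNorm z
      _ ≤ ‖T‖ * (‖x‖ + ‖y‖ + 1) := by gcongr
      _ < η * (‖x‖ + ‖y‖ + 1) := by gcongr
      _ = ε / 2 := hηε
  have bound' : ∀ (T : E →L[ℝ] E) (z w : E), dist z w < δ → ‖T‖ ≤ C + D + 1 →
      dist (T z) (T w) ≤ ε / 2 := fun T z w hz hT => by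
    rw [dist_eq_norm, ← map_sub]
    calc ‖T (z - w)‖ ≤ ‖T‖ * ‖z - w‖ := T.le_opNorm _
      _ ≤ (C + D + 1) * δ := by rw [← dist_eq_norm]; gcongr
      _ ≤ ε / 2 := hδε
  rcases le_or_gt N k with h | h
  · right
    have h1 := bound (S.P k) p x hp (hN k h).1 (by linarith [norm_nonneg y])
    have h2 := bound' (S.Q (l - k)) q y hq (by linarith [hD' (l - k)])
    calc dist (S.P k p + S.Q (l - k) q) (S.Q (l - k) y)
        ≤ dist (S.P k p + S.Q (l - k) q) (S.Q (l - k) q) +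
          dist (S.Q (l - k) q) (S.Q (l - k) y) := dist_triangle _ _ _
      _ = ‖S.P k p‖ + dist (S.Q (l - k) q) (S.Q (l - k) y) := by rw [dist_eq_norm]; simp
      _ < ε := by linarith
  · left
    have h1 := bound (S.Q (l - k)) q y hq (hN _ (by omega)).2 (by linarith [norm_nonneg x])
    have h2 := bound' (S.P k) p x hp (by linarith [hC' k])
    calc dist (S.P k p + S.Q (l - k) q) (S.P k x)
        ≤ dist (S.P k p + S.Q (l - k) q) (S.P k p) + dist (S.P k p) (S.P k x) :=
          dist_triangle _ _ _
      _ = ‖S.Q (l - k) q‖ + dist (S.P k p) (S.P k x) := by rw [dist_eq_norm]; simp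
      _ < ε := by linarith

end HyperbolicSplitting

variable {s u : ℕ}

/-- The block-diagonal map `(a, c, b)` of `ℝ^s × ℝ × ℝ^u`. -/
noncomputable def block (a : EuclideanSpace ℝ (Fin s) →L[ℝ] EuclideanSpace ℝ (Fin s)) (c : ℝ)
    (b : EuclideanSpace ℝ (Fin u) →L[ℝ] EuclideanSpace ℝ (Fin u)) : Coord s u →L[ℝ] Coord s u :=
  a.prodMap ((c • ContinuousLinearMap.id ℝ ℝ).prodMap b)

@[simp]
theorem block_apply (a : EuclideanSpace ℝ (Fin s) →L[ℝ] EuclideanSpace ℝ (Fin s)) (c : ℝ)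
    (b : EuclideanSpace ℝ (Fin u) →L[ℝ] EuclideanSpace ℝ (Fin u)) (x : Coord s u) :
    block a c b x = (a x.1, c * x.2.1, b x.2.2) := rfl

theorem block_pow (a : EuclideanSpace ℝ (Fin s) →L[ℝ] EuclideanSpace ℝ (Fin s)) (c : ℝ)
    (b : EuclideanSpace ℝ (Fin u) →L[ℝ] EuclideanSpace ℝ (Fin u)) (k : ℕ) (x : Coord s u) :
    (block a c b ^ k) x = ((a ^ k) x.1, c ^ k * x.2.1, (b ^ k) x.2.2) := by
  induction k generalizing x with
  | zero => simp
  | succ k ih =>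
    rw [pow_succ, mul_apply_eq_comp, ih]
    simp only [block_apply, pow_succ, mul_apply_eq_comp, mul_assoc]

theorem eigenvalues_block (a : EuclideanSpace ℝ (Fin s) →L[ℝ] EuclideanSpace ℝ (Fin s)) (c : ℝ)
    (b : EuclideanSpace ℝ (Fin u) →L[ℝ] EuclideanSpace ℝ (Fin u)) :
    eigenvalues (block a c b : Coord s u →ₗ[ℝ] Coord s u) =
      eigenvalues (a : EuclideanSpace ℝ (Fin s) →ₗ[ℝ] EuclideanSpace ℝ (Fin s)) + {(c : ℂ)} +
      eigenvalues (b : EuclideanSpace ℝ (Fin u) →ₗ[ℝ] EuclideanSpace ℝ (Fin u)) := by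
  have : (block a c b : Coord s u →ₗ[ℝ] Coord s u) =
      LinearMap.prodMap (a : EuclideanSpace ℝ (Fin s) →ₗ[ℝ] EuclideanSpace ℝ (Fin s))
        (LinearMap.prodMap (c • (LinearMap.id : ℝ →ₗ[ℝ] ℝ))
          (b : EuclideanSpace ℝ (Fin u) →ₗ[ℝ] EuclideanSpace ℝ (Fin u))) := rfl
  rw [this, eigenvalues_prodMap, eigenvalues_prodMap, eigenvalues_smul_id, add_assoc]

theorem tendsto_block {ι : Type*} {l : Filter ι}
    {a : ι → EuclideanSpace ℝ (Fin s) →L[ℝ] EuclideanSpace ℝ (Fin s)} {c : ι → ℝ}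
    {b : ι → EuclideanSpace ℝ (Fin u) →L[ℝ] EuclideanSpace ℝ (Fin u)}
    (ha : Tendsto a l (𝓝 0)) (hc : Tendsto c l (𝓝 0)) (hb : Tendsto b l (𝓝 0)) :
    Tendsto (fun i => block (a i) (c i) (b i)) l (𝓝 0) := by
  have hcont : Continuous fun t : (EuclideanSpace ℝ (Fin s) →L[ℝ] EuclideanSpace ℝ (Fin s)) × ℝ ×
      (EuclideanSpace ℝ (Fin u) →L[ℝ] EuclideanSpace ℝ (Fin u)) => block t.1 t.2.1 t.2.2 :=
    continuous_fst.prod_mapL ℝ <|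
      ((continuous_fst.comp continuous_snd).smul continuous_const).prod_mapL ℝ
        (continuous_snd.comp continuous_snd)
  have h0 : block (0 : EuclideanSpace ℝ (Fin s) →L[ℝ] EuclideanSpace ℝ (Fin s)) 0
      (0 : EuclideanSpace ℝ (Fin u) →L[ℝ] EuclideanSpace ℝ (Fin u)) = 0 := by
    ext x <;> simp
  have := (hcont.tendsto (0, 0, 0)).comp (ha.prodMk_nhds (hc.prodMk_nhds hb))
  simp only [h0] at this
  exact this

/-- The splitting of `(a, c, b)` with contracting central direction. -/
noncomputable def splittingOfContracting
    {a : EuclideanSpace ℝ (Fin s) →L[ℝ] EuclideanSpace ℝ (Fin s)} {c : ℝ}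
    {b b' : EuclideanSpace ℝ (Fin u) →L[ℝ] EuclideanSpace ℝ (Fin u)}
    (ha : Tendsto (fun k : ℕ => a ^ k) atTop (𝓝 0)) (hc : |c| < 1)
    (hb : Tendsto (fun k : ℕ => b' ^ k) atTop (𝓝 0))
    (h1 : ∀ x, b (b' x) = x) (h2 : ∀ x, b' (b x) = x) : HyperbolicSplitting (block a c b) where
  P k := block (a ^ k) (c ^ k) 0
  Q k := block 0 0 (b' ^ k)
  tendsto_P := tendsto_block ha (tendsto_pow_atTop_nhds_zero_of_abs_lt_one hc) tendsto_const_nhds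
  tendsto_Q := tendsto_block tendsto_const_nhds tendsto_const_nhds hb
  P_add_Q x := by simp
  map_P k x := by simp [pow_succ', mul_assoc]
  P_map k x := by simp [pow_succ, mul_assoc]
  map_Q k x := by simp [pow_succ', h1]
  Q_map k x := by simp [pow_succ, h2]

/-- The splitting of `(a, c, b)` with expanding central direction. -/
noncomputable def splittingOfExpanding
    {a : EuclideanSpace ℝ (Fin s) →L[ℝ] EuclideanSpace ℝ (Fin s)} {c : ℝ}
    {b b' : EuclideanSpace ℝ (Fin u) →L[ℝ] EuclideanSpace ℝ (Fin u)}
    (ha : Tendsto (fun k : ℕ => a ^ k) atTop (𝓝 0)) (hc : 1 < |c|)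
    (hb : Tendsto (fun k : ℕ => b' ^ k) atTop (𝓝 0))
    (h1 : ∀ x, b (b' x) = x) (h2 : ∀ x, b' (b x) = x) : HyperbolicSplitting (block a c b) where
  P k := block (a ^ k) 0 0
  Q k := block 0 (c⁻¹ ^ k) (b' ^ k)
  tendsto_P := tendsto_block ha tendsto_const_nhds tendsto_const_nhds
  tendsto_Q := tendsto_block tendsto_const_nhds
    (tendsto_pow_atTop_nhds_zero_of_abs_lt_one (by rw [abs_inv]; exact inv_lt_one_of_one_lt₀ hc)) hb
  P_add_Q x := by ext <;> simp
  map_P k x := by simp [pow_succ']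
  P_map k x := by simp [pow_succ]
  map_Q k x := by
    have : c ≠ 0 := by rintro rfl; simp at hc; linarith
    simp only [block_apply, pow_succ', mul_apply_eq_comp, h1]
    simp; field_simp
  Q_map k x := by
    have : c ≠ 0 := by rintro rfl; simp at hc; linarith
    simp only [block_apply, pow_succ, mul_apply_eq_comp, h2]
    simp; field_simp

end Splitting

/-! ### Orbit equivalence and asymptotic limits. -/

section Orbits

variable {M : Type*}

theorem iterate_mul_succ_apply (f : M → M) (n k : ℕ) (x : M) :
    f^[n * (k + 1)] x = f^[n] (f^[n * k] x) := by
  rw [← iterate_add_apply, mul_add, mul_one, add_comm]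

theorem iterate_iterate_comm (f : M → M) (m n : ℕ) (x : M) : f^[m] (f^[n] x) = f^[n] (f^[m] x) := by
  rw [← iterate_add_apply, ← iterate_add_apply, add_comm]

/-- Two points lie on the same orbit of `f`. -/
def SameOrbit (f : M → M) (x y : M) : Prop := ∃ a b : ℕ, f^[a] x = f^[b] y

theorem SameOrbit.refl (f : M → M) (x : M) : SameOrbit f x x := ⟨0, 0, rfl⟩

theorem SameOrbit.symm {f : M → M} {x y : M} (h : SameOrbit f x y) : SameOrbit f y x :=
  let ⟨a, b, h⟩ := h
  ⟨b, a, h.symm⟩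

theorem SameOrbit.trans {f : M → M} {x y z : M} (h : SameOrbit f x y) (h' : SameOrbit f y z) :
    SameOrbit f x z := by
  obtain ⟨a, b, h⟩ := h
  obtain ⟨c, d, h'⟩ := h'
  refine ⟨c + a, b + d, ?_⟩
  rw [iterate_add_apply, h, ← iterate_add_apply, add_comm, iterate_add_apply, h',
    ← iterate_add_apply]

theorem sameOrbit_iterate (f : M → M) (n : ℕ) (x : M) : SameOrbit f (f^[n] x) x :=
  ⟨0, n, rfl⟩

theorem sameOrbit_iterate_inverse {f g : M → M} (h : RightInverse g f) (n : ℕ) (x : M) :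
    SameOrbit f (g^[n] x) x :=
  ⟨n, 0, h.iterate n x⟩

theorem mem_fullOrbit_iff {f : M → M} (hf : Injective f) {x y : M} :
    y ∈ fullOrbit f x ↔ SameOrbit f y x := by
  constructor
  · rintro ⟨n, h | h⟩
    · exact ⟨0, n, h.symm⟩
    · exact ⟨n, 0, h⟩
  · rintro ⟨a, b, h⟩
    rcases le_total a b with hab | hab
    · obtain ⟨c, rfl⟩ := Nat.exists_eq_add_of_le hab
      refine ⟨c, Or.inl ?_⟩
      rw [iterate_add_apply] at h
      exact (hf.iterate a h).symm
    · obtain ⟨c, rfl⟩ := Nat.exists_eq_add_of_le hab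
      refine ⟨c, Or.inr ?_⟩
      rw [iterate_add_apply] at h
      exact hf.iterate b h

variable [TopologicalSpace M] [T2Space M]

/-- The relation `f^a x = f^b y` passes to the limit along the common multiples of `n` and `m`,
because `g` commutes with `f`. It is used with `g = f` for forward limits and with `g = f.symm` for
backward ones. -/
theorem sameOrbit_of_tendsto {f g : M → M} (hf : Continuous f) (hgf : Function.Commute g f)
    {n m : ℕ} (hn : 0 < n) (hm : 0 < m) {x y p q : M}
    (hx : Tendsto (fun k : ℕ => g^[n * k] x) atTop (𝓝 p))
    (hy : Tendsto (fun k : ℕ => g^[m * k] y) atTop (𝓝 q)) (h : SameOrbit f x y) :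
    SameOrbit f p q := by
  obtain ⟨a, b, hab⟩ := h
  refine ⟨a, b, ?_⟩
  have h1 : Tendsto (fun k : ℕ => f^[a] (g^[n * (m * k)] x)) atTop (𝓝 (f^[a] p)) :=
    ((hf.iterate a).tendsto p).comp (hx.comp (tendsto_id.const_mul_atTop' hm))
  have h2 : Tendsto (fun k : ℕ => f^[b] (g^[m * (n * k)] y)) atTop (𝓝 (f^[b] q)) :=
    ((hf.iterate b).tendsto q).comp (hy.comp (tendsto_id.const_mul_atTop' hn))
  refine tendsto_nhds_unique h1 (h2.congr fun k => ?_)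
  rw [← (hgf.iterate_iterate _ _).eq, ← (hgf.iterate_iterate _ _).eq, hab, mul_left_comm]

theorem eq_of_tendsto_of_periodic {f : M → M} {n N : ℕ} (hN : 0 < N) {x p : M}
    (hx : Tendsto (fun k : ℕ => f^[n * k] x) atTop (𝓝 p)) (h : f^[N] x = x) : x = p := by
  refine tendsto_nhds_unique (f := fun k : ℕ => f^[n * (N * k)] x) (l := atTop) ?_
    (hx.comp (tendsto_id.const_mul_atTop' hN))
  have : ∀ k : ℕ, f^[n * (N * k)] x = x := fun k => by
    have h1 : IsPeriodicPt f N x := h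
    have := h1.mul_const (n * k)
    rwa [show N * (n * k) = n * (N * k) by ring] at this
  simp only [this]
  exact tendsto_const_nhds

end Orbits

end HeteroCycle

namespace HeteroCycle

/-- Only the images `f z, …, f^n z` must avoid `W`; the initial point itself may lie in `W`. -/
theorem iterate_eq_of_avoid {M : Type*} {f g : M → M} {W : Set M} (hg : ∀ z, f z ∉ W → g z = f z) {z : M} {n : ℕ}
    (h : ∀ j < n, f^[j + 1] z ∉ W) {j : ℕ} (hj : j ≤ n) : g^[j] z = f^[j] z := by
  induction j with
  | zero => rfl
  | succ j ih =>
    rw [iterate_succ_apply', ih (by omega), iterate_succ_apply']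
    refine hg _ ?_
    rw [← iterate_succ_apply' f]
    exact h j (by omega)

/-! ### Concatenation of orbit segments read in charts. -/

section Segments

variable {M E : Type*} [TopologicalSpace M] [TopologicalSpace E]

/-- The orbit segment `x, g x, …, g ^ (n - 1) x` lies in `V`, and near `x` the map `g ^ n` reads `Φ`
in the charts `c₁` and `c₂`. -/
structure Segment (V : Set M) (c₁ c₂ : OpenPartialHomeomorph M E) (g : M → M) (n : ℕ) (Φ : E → E)
    (x : M) : Prop where
  mem : ∀ j < n, g^[j] x ∈ V
  conj : ∀ᶠ z in 𝓝 x, z ∈ c₁.source ∧ g^[n] z ∈ c₂.source ∧ c₂ (g^[n] z) = Φ (c₁ z)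

theorem conj_comp {c₁ c₂ c₃ : OpenPartialHomeomorph M E} {g : M → M} (hg : Continuous g) {n m : ℕ}
    {Φ Ψ : E → E} {x : M}
    (h : ∀ᶠ z in 𝓝 x, z ∈ c₁.source ∧ g^[n] z ∈ c₂.source ∧ c₂ (g^[n] z) = Φ (c₁ z))
    (h' : ∀ᶠ z in 𝓝 (g^[n] x), z ∈ c₂.source ∧ g^[m] z ∈ c₃.source ∧ c₃ (g^[m] z) = Ψ (c₂ z)) :
    ∀ᶠ z in 𝓝 x, z ∈ c₁.source ∧ g^[m + n] z ∈ c₃.source ∧ c₃ (g^[m + n] z) = (Ψ ∘ Φ) (c₁ z) := by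
  filter_upwards [h, ((hg.iterate n).tendsto x).eventually h'] with z hz hz'
  rw [iterate_add_apply]
  exact ⟨hz.1, hz'.2.1, by rw [hz'.2.2, hz.2.2]; rfl⟩

theorem Segment.comp {V : Set M} {c₁ c₂ c₃ : OpenPartialHomeomorph M E} {g : M → M}
    (hg : Continuous g) {n m : ℕ} {Φ Ψ : E → E} {x : M} (h : Segment V c₁ c₂ g n Φ x)
    (h' : Segment V c₂ c₃ g m Ψ (g^[n] x)) : Segment V c₁ c₃ g (m + n) (Ψ ∘ Φ) x := by
  refine ⟨fun j hj => ?_, conj_comp hg h.conj h'.conj⟩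
  rcases lt_or_ge j n with hjn | hjn
  · exact h.mem j hjn
  · obtain ⟨i, rfl⟩ := Nat.exists_eq_add_of_le' hjn
    rw [iterate_add_apply]
    exact h'.mem i (by omega)

theorem Segment.end_mem {V : Set M} {c₁ c₂ : OpenPartialHomeomorph M E} {g : M → M} {n : ℕ}
    {Φ : E → E} {x : M} (h : Segment V c₁ c₂ g n Φ x) : g^[n] x ∈ c₂.source :=
  h.conj.self_of_nhds.2.1

theorem Segment.end_eq {V : Set M} {c₁ c₂ : OpenPartialHomeomorph M E} {g : M → M} {n : ℕ}
    {Φ : E → E} {x : M} (h : Segment V c₁ c₂ g n Φ x) : c₂ (g^[n] x) = Φ (c₁ x) :=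
  h.conj.self_of_nhds.2.2

/-- The hypothesis `H` concerns only points with prescribed coordinates. Hence the caller can check
it by a computation in the linear model, without knowing the orbit of `g` beforehand. -/
theorem Segment.iterate {V : Set M} {c : OpenPartialHomeomorph M E} {g : M → M}
    (hg : Continuous g) {n : ℕ} {Φ : E → E} {x : M} (hx : x ∈ c.source) (l : ℕ)
    (H : ∀ k < l, ∀ z ∈ c.source, c z = Φ^[k] (c x) → Segment V c c g n Φ z) :
    Segment V c c g (l * n) Φ^[l] x := by
  induction l with
  | zero =>
    refine ⟨by simp, ?_⟩
    filter_upwards [c.open_source.mem_nhds hx] with z hz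
    simpa using hz
  | succ l ih =>
    have h := ih fun k hk => H k (by omega)
    have := h.comp hg (H l (by omega) _ h.end_mem h.end_eq)
    rwa [show n + l * n = (l + 1) * n by ring, ← iterate_succ'] at this

end Segments

/-! ### Multipliers computed in a chart. -/

section Multipliers

variable {s u : ℕ} {M : Type*} [TopologicalSpace M]
  [ChartedSpace (EuclideanSpace ℝ (Fin (s + 1 + u))) M]

/-- The eigenvalues of the derivative at a fixed point can be computed in any chart. -/
theorem eigenvalues_mfderiv {g : M → M} {R : M} {c : OpenPartialHomeomorph M (Coord s u)}
    (hc : ContMDiffOn (𝓡 (s + 1 + u)) (modelWithCornersSelf ℝ (Coord s u)) 1 c c.source)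
    (hc' : ContMDiffOn (modelWithCornersSelf ℝ (Coord s u)) (𝓡 (s + 1 + u)) 1 c.symm c.target)
    (hR : R ∈ c.source) (hg : MDifferentiableAt (𝓡 (s + 1 + u)) (𝓡 (s + 1 + u)) g R)
    (hgR : g R = R) {Φ : Coord s u → Coord s u} {D : Coord s u →L[ℝ] Coord s u}
    (hΦ : HasFDerivAt Φ D (c R)) (hconj : ∀ᶠ z in 𝓝 R, c (g z) = Φ (c z))
    (G : EuclideanSpace ℝ (Fin (s + 1 + u)) →L[ℝ] EuclideanSpace ℝ (Fin (s + 1 + u)))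
    (hG : G = mfderiv (𝓡 (s + 1 + u)) (𝓡 (s + 1 + u)) g R) :
    eigenvalues (G : EuclideanSpace ℝ (Fin (s + 1 + u)) →ₗ[ℝ] EuclideanSpace ℝ (Fin (s + 1 + u))) =
      eigenvalues (D : Coord s u →ₗ[ℝ] Coord s u) := by
  have hcd : MDifferentiableAt (𝓡 (s + 1 + u)) (modelWithCornersSelf ℝ (Coord s u)) c R :=
    (hc.contMDiffAt (c.open_source.mem_nhds hR)).mdifferentiableAt one_ne_zero
  have hcd' : MDifferentiableAt (modelWithCornersSelf ℝ (Coord s u)) (𝓡 (s + 1 + u)) c.symm (c R) :=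
    (hc'.contMDiffAt (c.open_target.mem_nhds (c.map_source hR))).mdifferentiableAt one_ne_zero
  let e : EuclideanSpace ℝ (Fin (s + 1 + u)) →L[ℝ] Coord s u :=
    mfderiv (𝓡 (s + 1 + u)) (modelWithCornersSelf ℝ (Coord s u)) c R
  let e' : Coord s u →L[ℝ] EuclideanSpace ℝ (Fin (s + 1 + u)) :=
    mfderiv (modelWithCornersSelf ℝ (Coord s u)) (𝓡 (s + 1 + u)) c.symm (c R)
  have he : HasMFDerivAt (𝓡 (s + 1 + u)) (modelWithCornersSelf ℝ (Coord s u)) c R e :=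
    hcd.hasMFDerivAt
  have he' : HasMFDerivAt (modelWithCornersSelf ℝ (Coord s u)) (𝓡 (s + 1 + u)) c.symm (c R) e' :=
    hcd'.hasMFDerivAt
  have hGd : HasMFDerivAt (𝓡 (s + 1 + u)) (𝓡 (s + 1 + u)) g R G := by
    rw [hG]; exact hg.hasMFDerivAt
  have h1 : e'.comp e = ContinuousLinearMap.id ℝ (EuclideanSpace ℝ (Fin (s + 1 + u))) := by
    refine hasMFDerivAt_unique (he'.comp R he) ?_
    refine (hasMFDerivAt_id R).congr_of_eventuallyEq ?_
    filter_upwards [c.open_source.mem_nhds hR] with z hz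
    simp [c.left_inv hz]
  have h2 : e.comp e' = ContinuousLinearMap.id ℝ (Coord s u) := by
    have he2 : HasMFDerivAt (𝓡 (s + 1 + u)) (modelWithCornersSelf ℝ (Coord s u)) c
        (c.symm (c R)) e := by
      have := c.left_inv hR
      exact this.symm ▸ he
    refine hasMFDerivAt_unique (he2.comp (c R) he') ?_
    refine (hasMFDerivAt_id (c R)).congr_of_eventuallyEq ?_
    filter_upwards [c.open_target.mem_nhds (c.map_source hR)] with z hz
    simp [c.right_inv hz]
  -- The chain rule for `c ∘ g = Φ ∘ c` at the fixed point. With `h1` and `h2` it makes `G` and `D`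
  -- conjugate by the derivative of the chart.
  have h3 : e.comp G = D.comp e := by
    have heg : HasMFDerivAt (𝓡 (s + 1 + u)) (modelWithCornersSelf ℝ (Coord s u)) c (g R) e :=
      hgR.symm ▸ he
    refine hasMFDerivAt_unique (heg.comp R hGd) ?_
    exact (hΦ.hasMFDerivAt.comp R he).congr_of_eventuallyEq hconj
  let ee : EuclideanSpace ℝ (Fin (s + 1 + u)) ≃ₗ[ℝ] Coord s u :=
    LinearEquiv.ofLinearMap (e : EuclideanSpace ℝ (Fin (s + 1 + u)) →ₗ[ℝ] Coord s u)
      (e' : Coord s u →ₗ[ℝ] EuclideanSpace ℝ (Fin (s + 1 + u)))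
      (LinearMap.ext fun x => congrArg (fun T => T x) h2)
      (LinearMap.ext fun x => congrArg (fun T => T x) h1)
  exact eigenvalues_conj ee _ _ fun x => congrArg (fun T => T x) h3

theorem contMDiff_iterate (f : Diffeomorph (𝓡 (s + 1 + u)) (𝓡 (s + 1 + u)) M M 1) (n : ℕ) :
    ContMDiff (𝓡 (s + 1 + u)) (𝓡 (s + 1 + u)) 1 f^[n] := by
  induction n with
  | zero => exact contMDiff_id
  | succ n ih => rw [iterate_succ']; exact f.contMDiff.comp ih

theorem multipliers_eq (f : Diffeomorph (𝓡 (s + 1 + u)) (𝓡 (s + 1 + u)) M M 1) {R : M}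
    {c : OpenPartialHomeomorph M (Coord s u)}
    (hc : ContMDiffOn (𝓡 (s + 1 + u)) (modelWithCornersSelf ℝ (Coord s u)) 1 c c.source)
    (hc' : ContMDiffOn (modelWithCornersSelf ℝ (Coord s u)) (𝓡 (s + 1 + u)) 1 c.symm c.target)
    (hR : R ∈ c.source) {Φ : Coord s u → Coord s u} {D : Coord s u →L[ℝ] Coord s u}
    (hΦ : HasFDerivAt Φ D (c R)) (hconj : ∀ᶠ z in 𝓝 R, c (f^[minimalPeriod f R] z) = Φ (c z)) :
    multipliers (d := s + 1 + u) f R = eigenvalues (D : Coord s u →ₗ[ℝ] Coord s u) :=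
  eigenvalues_mfderiv hc hc' hR ((contMDiff_iterate f _).contMDiffAt.mdifferentiableAt one_ne_zero)
    (isPeriodicPt_minimalPeriod f R) hΦ hconj _ rfl

end Multipliers

/-! ### Local dynamics near a saddle of the cycle. -/

section Saddle

variable {s u : ℕ} {M : Type*} [TopologicalSpace M]
  [ChartedSpace (EuclideanSpace ℝ (Fin (s + 1 + u))) M]

namespace LinearizingChart

variable {f : M → M} {p : M} (c : LinearizingChart (s := s) (u := u) f p)

/-- The linear map to which the chart conjugates the return map. -/
noncomputable def L : Coord s u →L[ℝ] Coord s u :=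
  block (LinearMap.toContinuousLinearMap c.Ls) c.lam (LinearMap.toContinuousLinearMap c.Lu)

theorem chart_iterate {z : M} (hz : z ∈ c.chart.source)
    (hz' : f^[minimalPeriod f p] z ∈ c.chart.source) :
    c.chart (f^[minimalPeriod f p] z) = c.L (c.chart z) := c.linear z hz hz'

theorem tendsto_chart {ι : Type*} {l : Filter ι} {x : ι → M} (h : Tendsto x l (𝓝 p)) :
    Tendsto (fun i => c.chart (x i)) l (𝓝 0) := by
  have := (c.chart.continuousAt c.mem_source).tendsto.comp h
  rwa [c.map_center] at this

theorem chart_of_mem_stable {x : M} {k : ℕ}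
    (h : ∀ k, f^[minimalPeriod f p * k] x ∈ c.chart.source) :
    c.chart (f^[minimalPeriod f p * k] x) = (c.L ^ k) (c.chart x) := by
  induction k with
  | zero => simp
  | succ k ih =>
    have h1 := h (k + 1)
    rw [mul_add, mul_one, add_comm, iterate_add_apply] at h1 ⊢
    rw [c.chart_iterate (h k) h1, ih, pow_succ', mul_apply_eq_comp]

theorem Q_chart_of_mem_stable (S : HyperbolicSplitting c.L) {x : M}
    (h : x ∈ localStableSet f (minimalPeriod f p) p c.chart.source) : S.Q 0 (c.chart x) = 0 := by
  refine S.Q_eq_zero_of_tendsto ((c.tendsto_chart h.2).congr fun k => ?_)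
  rw [c.chart_of_mem_stable h.1]

theorem chart_stable_eq (S : HyperbolicSplitting c.L) {x : M}
    (h : x ∈ localStableSet f (minimalPeriod f p) p c.chart.source) (k : ℕ) :
    c.chart (f^[minimalPeriod f p * k] x) = S.P k (c.chart x) := by
  rw [c.chart_of_mem_stable h.1, S.pow_eq_P (c.Q_chart_of_mem_stable S h)]

theorem chart_of_mem_unstable {g : M → M} (hg : RightInverse g f) {x : M} {k : ℕ}
    (h : ∀ k, g^[minimalPeriod f p * k] x ∈ c.chart.source) :
    (c.L ^ k) (c.chart (g^[minimalPeriod f p * k] x)) = c.chart x := by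
  induction k with
  | zero => simp
  | succ k ih =>
    have h1 : f^[minimalPeriod f p] (g^[minimalPeriod f p * (k + 1)] x) =
        g^[minimalPeriod f p * k] x := by
      rw [mul_add, mul_one, add_comm, iterate_add_apply]
      exact hg.iterate _ _
    rw [pow_succ, mul_apply_eq_comp, ← c.chart_iterate (h (k + 1)) (h1 ▸ h k), h1, ih]

theorem P_chart_of_mem_unstable (S : HyperbolicSplitting c.L) {g : M → M} (hg : RightInverse g f)
    {x : M} (h : x ∈ localStableSet g (minimalPeriod f p) p c.chart.source) :
    S.P 0 (c.chart x) = 0 :=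
  S.P_eq_zero_of_tendsto (fun _ => c.chart_of_mem_unstable hg h.1) (c.tendsto_chart h.2)

theorem chart_unstable_eq (S : HyperbolicSplitting c.L) {g : M → M} (hg : RightInverse g f)
    {x : M} (h : x ∈ localStableSet g (minimalPeriod f p) p c.chart.source) (k : ℕ) :
    c.chart (g^[minimalPeriod f p * k] x) = S.Q k (c.chart x) := by
  refine S.eq_Q (c.chart_of_mem_unstable hg h.1) (c.P_chart_of_mem_unstable S hg ⟨fun j => ?_, ?_⟩)
  · rw [← iterate_add_apply, ← mul_add]
    exact h.1 _
  · have := h.2.comp (tendsto_add_atTop_nat k)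
    refine this.congr fun j => ?_
    rw [Function.comp_apply, mul_add, iterate_add_apply]

/-- Points of the domain whose return is in the domain, with orbit segment in `V` avoiding `W`. -/
def goodSet (V W : Set M) : Set M :=
  {z | z ∈ c.chart.source ∧ f^[minimalPeriod f p] z ∈ c.chart.source ∧
    ∀ j < minimalPeriod f p, f^[j] z ∈ V ∧ f^[j + 1] z ∉ W}

theorem isOpen_goodSet (hf : Continuous f) {V W : Set M} (hV : IsOpen V) (hW : IsClosed W) :
    IsOpen (c.goodSet V W) := by
  have h3 : IsOpen (⋂ j ∈ Finset.range (minimalPeriod f p),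
      (f^[j] ⁻¹' V ∩ f^[j + 1] ⁻¹' Wᶜ)) :=
    isOpen_biInter_finset fun j _ => (hV.preimage (hf.iterate j)).inter
      (hW.isOpen_compl.preimage (hf.iterate (j + 1)))
  convert (c.chart.open_source.inter 
    (c.chart.open_source.preimage (hf.iterate (minimalPeriod f p)))).inter h3 using 1
  ext z
  simp only [goodSet, Set.mem_ofPred_eq, Set.mem_inter_iff, Set.mem_preimage, Set.mem_iInter,
    Finset.mem_range, Set.mem_compl_iff, and_assoc]

theorem segment_of_mem_goodSet (hf : Continuous f) {V W : Set M} (hV : IsOpen V) (hW : IsClosed W)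
    {g : M → M} (hg : ∀ z, f z ∉ W → g z = f z) {z : M} (hz : z ∈ c.goodSet V W) :
    Segment V c.chart c.chart g (minimalPeriod f p) c.L z := by
  have h : ∀ z ∈ c.goodSet V W, ∀ j ≤ minimalPeriod f p, g^[j] z = f^[j] z := fun z hz j hj =>
    iterate_eq_of_avoid hg (fun i hi => (hz.2.2 i hi).2) hj
  refine ⟨fun j hj => ?_, ?_⟩
  · rw [h z hz j hj.le]
    exact (hz.2.2 j hj).1
  · filter_upwards [(c.isOpen_goodSet hf hV hW).mem_nhds hz] with y hy
    rw [h y hy _ le_rfl]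
    exact ⟨hy.1, hy.2.1, c.chart_iterate hy.1 hy.2.1⟩

/-- Long orbit segments near the saddle `p`, from near the point `x` of the local stable manifold to
near the point `y` of the local unstable manifold. -/
theorem exists_segments (S : HyperbolicSplitting c.L) (hf : Continuous f) {g : M → M}
    (hgf : RightInverse g f) (V W : Set M) (hV : IsOpen V) (hW : IsClosed W)
    (hp : p ∈ c.goodSet V W) {x y : M}
    (hx : x ∈ localStableSet f (minimalPeriod f p) p c.chart.source)
    (hy : y ∈ localStableSet g (minimalPeriod f p) p c.chart.source)
    (hxG : ∀ k, f^[minimalPeriod f p * k] x ∈ c.goodSet V W)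
    (hyG : ∀ k, g^[minimalPeriod f p * (k + 1)] y ∈ c.goodSet V W) :
    ∃ δ > 0, ∃ N, ∀ l ≥ N, ∀ a b, dist a (c.chart x) < δ → dist b (c.chart y) < δ →
      ∀ h : M → M, Continuous h → (∀ z, f z ∉ W → h z = f z) →
      ∀ z ∈ c.chart.source, c.chart z = S.P 0 a + S.Q l b →
        Segment V c.chart c.chart h (l * minimalPeriod f p) c.L^[l] z := by
  set G := c.goodSet V W with hGdef
  have hGs : G ⊆ c.chart.source := fun z hz => hz.1
  have hGo : IsOpen G := c.isOpen_goodSet hf hV hW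
  set K₁ := insert p (Set.range fun k : ℕ => f^[minimalPeriod f p * k] x)
  set K₂ := insert p (Set.range fun k : ℕ => g^[minimalPeriod f p * (k + 1)] y)
  -- A convergent sequence together with its limit is compact, so its chart image has a uniform
  -- thickening inside the image of the good set.
  have hK : IsCompact (K₁ ∪ K₂) :=
    hx.2.isCompact_insert_range.union (hy.2.comp (tendsto_add_atTop_nat 1)).isCompact_insert_range
  have hKG : K₁ ∪ K₂ ⊆ G := by
    rintro z ((rfl | ⟨k, rfl⟩) | (rfl | ⟨k, rfl⟩))
    exacts [hp, hxG k, hp, hyG k]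
  have hKc : IsCompact (c.chart '' (K₁ ∪ K₂)) :=
    hK.image_of_continuousOn (c.chart.continuousOn.mono (hKG.trans hGs))
  have hGc : IsOpen (c.chart '' G) := c.chart.isOpen_image_of_subset_source hGo hGs
  obtain ⟨ε, hε, hth⟩ := hKc.exists_thickening_subset_open hGc (Set.image_mono hKG)
  obtain ⟨δ, hδ, N, hN⟩ := S.shadowing (c.chart x) (c.chart y) hε
  refine ⟨δ, hδ, N, fun l hl a b ha hb h hh hhf z hz hzc => ?_⟩
  refine Segment.iterate hh hz l fun k hk w hw hwc => ?_
  refine c.segment_of_mem_goodSet hf hV hW hhf ?_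
  have hwc' : c.chart w = S.P k a + S.Q (l - k) b := by
    rw [hwc, hzc, ← S.pow_add hk.le]
    simp
  have hmem : c.chart w ∈ c.chart '' G := by
    refine hth (Metric.mem_thickening_iff.2 ?_)
    rcases hN l hl a b ha hb k hk.le with hd | hd
    · refine ⟨_, ⟨_, Or.inl (Or.inr ⟨k, rfl⟩), c.chart_stable_eq S hx k⟩, hwc' ▸ hd⟩
    -- The return map is applied only at times `k < l`, so the shadowed point is a proper backward
    -- iterate of `y`. Therefore `y` itself need not be in the good set.
    · obtain ⟨j, hj⟩ : ∃ j, l - k = j + 1 := ⟨l - k - 1, by omega⟩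
      refine ⟨_, ⟨_, Or.inr (Or.inr ⟨j, rfl⟩), c.chart_unstable_eq S hgf hy (j + 1)⟩, ?_⟩
      rw [hwc', ← hj]
      exact hd
  obtain ⟨v, hv, hvw⟩ := hmem
  rwa [← c.chart.injOn (hGs hv) hw hvw]

end LinearizingChart

end Saddle

end HeteroCycle

/-! ### The orbits of the cycle and neighborhoods avoiding `X⁻`. -/

namespace HeteroCycle

namespace SimpleCycle

variable {s u : ℕ} {M : Type*} [TopologicalSpace M] [T2Space M]
  [ChartedSpace (EuclideanSpace ℝ (Fin (s + 1 + u))) M]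
  {f : Diffeomorph (𝓡 (s + 1 + u)) (𝓡 (s + 1 + u)) M M 1}

section
variable {s u : ℕ} {M : Type*} [TopologicalSpace M]
  [ChartedSpace (EuclideanSpace ℝ (Fin (s + 1 + u))) M]
  (f : Diffeomorph (𝓡 (s + 1 + u)) (𝓡 (s + 1 + u)) M M 1)

theorem rightInverse_symm : RightInverse f.symm f := f.apply_symm_apply

theorem leftInverse_symm : LeftInverse f.symm f := f.symm_apply_apply

theorem commute_symm : Function.Commute f.symm f := fun x => by
  rw [f.symm_apply_apply, f.apply_symm_apply]

theorem iterate_symm_of_periodic {n : ℕ} {x : M} (h : f^[n] x = x) (k : ℕ) :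
    f.symm^[n * k] x = x := by
  have h1 : IsPeriodicPt f n x := h
  have h2 : f^[n * k] x = x := h1.mul_const k
  conv_lhs => rw [← h2]
  exact (leftInverse_symm f).iterate _ x

variable {f} in
theorem iterate_of_iterate_symm {x : M} {n j : ℕ} {w : M} (hj : j ≤ n)
    (h : f^[j] (f.symm^[n] x) = w) : f^[n - j] w = x := by
  rw [← h, ← iterate_add_apply, Nat.sub_add_cancel hj]
  exact (rightInverse_symm f).iterate n x

end

variable (C : SimpleCycle s u f)

section
variable {s u : ℕ} {M : Type*} [TopologicalSpace M]
  [ChartedSpace (EuclideanSpace ℝ (Fin (s + 1 + u))) M]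
  {f : Diffeomorph (𝓡 (s + 1 + u)) (𝓡 (s + 1 + u)) M M 1} (C : SimpleCycle s u f)

theorem period_A_pos : 0 < minimalPeriod f C.A := minimalPeriod_pos_of_mem_periodicPts C.periodic_A

theorem period_B_pos : 0 < minimalPeriod f C.B := minimalPeriod_pos_of_mem_periodicPts C.periodic_B

theorem iterate_A (k : ℕ) : f^[minimalPeriod f C.A * k] C.A = C.A :=
  (isPeriodicPt_minimalPeriod f C.A).mul_const k

theorem iterate_B (k : ℕ) : f^[minimalPeriod f C.B * k] C.B = C.B :=
  (isPeriodicPt_minimalPeriod f C.B).mul_const k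

theorem not_sameOrbit_A_B : ¬ SameOrbit f C.A C.B := by
  rintro ⟨a, b, h⟩
  -- From `f^a A = f^b B`, iterate on to time `π(B) b`, when the orbit of `B` is back at `B`.
  apply C.orbits_ne ((minimalPeriod f C.B * b - b) + a)
  rw [iterate_add_apply, h, ← iterate_add_apply, Nat.sub_add_cancel]
  · exact C.iterate_B b
  · exact Nat.le_mul_of_pos_left _ C.period_B_pos

end

/-- Here and in the next lemmas, two points on one orbit have limits on one orbit. The backward
limit of `X⁻` is `B`, whereas that of `A` along multiples of its period is `A`. For the pair `X⁻`,
`B` the forward limits are compared instead. -/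
theorem not_sameOrbit_Xm_A : ¬ SameOrbit f C.Xm C.A := fun h => by
  refine C.not_sameOrbit_A_B (SameOrbit.symm (sameOrbit_of_tendsto f.continuous (commute_symm f)
    C.period_B_pos C.period_A_pos C.Xm_mem.2 ?_ h))
  simp only [iterate_symm_of_periodic f (isPeriodicPt_minimalPeriod f C.A)]
  exact tendsto_const_nhds

theorem not_sameOrbit_Xm_B : ¬ SameOrbit f C.Xm C.B := fun h => by
  refine C.not_sameOrbit_A_B (sameOrbit_of_tendsto f.continuous (Function.Commute.refl f)
    C.period_A_pos C.period_B_pos C.Xp_mem.2 ?_ ((sameOrbit_iterate f _ _).trans h))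
  simp only [C.iterate_B]
  exact tendsto_const_nhds

theorem not_sameOrbit_Ym_A : ¬ SameOrbit f C.Ym C.A := fun h => by
  refine C.not_sameOrbit_A_B (SameOrbit.symm (sameOrbit_of_tendsto f.continuous
    (Function.Commute.refl f) C.period_B_pos C.period_A_pos C.Yp_mem.2 ?_
    ((sameOrbit_iterate f _ _).trans h)))
  simp only [C.iterate_A]
  exact tendsto_const_nhds

theorem not_sameOrbit_Ym_B : ¬ SameOrbit f C.Ym C.B := fun h => by
  refine C.not_sameOrbit_A_B (sameOrbit_of_tendsto f.continuous (commute_symm f)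
    C.period_A_pos C.period_B_pos C.Ym_mem.2 ?_ h)
  simp only [iterate_symm_of_periodic f (isPeriodicPt_minimalPeriod f C.B)]
  exact tendsto_const_nhds

theorem not_sameOrbit_Xm_Ym : ¬ SameOrbit f C.Xm C.Ym := fun h =>
  C.not_sameOrbit_A_B (sameOrbit_of_tendsto f.continuous (Function.Commute.refl f)
    C.period_A_pos C.period_B_pos C.Xp_mem.2 C.Yp_mem.2
    ((sameOrbit_iterate f _ _).trans (h.trans (sameOrbit_iterate f _ _).symm)))

theorem Xm_not_periodic {n : ℕ} (hn : 0 < n) : f^[n] C.Xm ≠ C.Xm := fun h => by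
  have h1 : f^[n] (f^[C.tba] C.Xm) = f^[C.tba] C.Xm := by
    rw [iterate_iterate_comm, h]
  have h2 := eq_of_tendsto_of_periodic hn C.Xp_mem.2 h1
  exact C.not_sameOrbit_Xm_A ⟨C.tba, 0, h2⟩

theorem Yp_not_periodic {n : ℕ} (hn : 0 < n) : f^[n] (f^[C.tab] C.Ym) ≠ f^[C.tab] C.Ym :=
  fun h => C.not_sameOrbit_Ym_B ⟨C.tab, 0, eq_of_tendsto_of_periodic hn C.Yp_mem.2 h⟩

theorem Ym_not_periodic {n : ℕ} (hn : 0 < n) : f^[n] C.Ym ≠ C.Ym := fun h => by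
  refine C.Yp_not_periodic hn ?_
  rw [iterate_iterate_comm, h]

/-- The points of the local pieces of the cycle near `A`, from which the return map is applied. -/
def localA : Set M :=
  insert C.A (Set.range fun k : ℕ => f^[minimalPeriod f C.A * k] (f^[C.tba] C.Xm)) ∪
    insert C.A (Set.range fun k : ℕ => f.symm^[minimalPeriod f C.A * (k + 1)] C.Ym)

/-- The points of the local pieces of the cycle near `B`, from which the return map is applied. -/
def localB : Set M :=
  insert C.B (Set.range fun k : ℕ => f^[minimalPeriod f C.B * k] (f^[C.tab] C.Ym)) ∪
    insert C.B (Set.range fun k : ℕ => f.symm^[minimalPeriod f C.B * (k + 1)] C.Xm)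

/-- The union of the orbits of the cycle without the point `X⁻`. -/
def puncturedOrbits : Set M :=
  ((⋃ j ∈ Finset.range (minimalPeriod f C.A), f^[j] '' C.localA) ∪
    (⋃ j ∈ Finset.range (minimalPeriod f C.B), f^[j] '' C.localB)) ∪
  ((⋃ j ∈ Finset.range C.tba \ {0}, {f^[j] C.Xm}) ∪ ⋃ j ∈ Finset.range C.tab, {f^[j] C.Ym})

section
variable {s u : ℕ} {M : Type*} [TopologicalSpace M]
  [ChartedSpace (EuclideanSpace ℝ (Fin (s + 1 + u))) M]
  {f : Diffeomorph (𝓡 (s + 1 + u)) (𝓡 (s + 1 + u)) M M 1} (C : SimpleCycle s u f)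

/-- Removing `X⁻` keeps compactness: what remains is a finite union of points and of iterates of
convergent sequences with their limits. -/
theorem isCompact_puncturedOrbits : IsCompact C.puncturedOrbits := by
  have hA : IsCompact C.localA := C.Xp_mem.2.isCompact_insert_range.union
    (C.Ym_mem.2.comp (tendsto_add_atTop_nat 1)).isCompact_insert_range
  have hB : IsCompact C.localB := C.Yp_mem.2.isCompact_insert_range.union
    (C.Xm_mem.2.comp (tendsto_add_atTop_nat 1)).isCompact_insert_range
  refine IsCompact.union (IsCompact.union ?_ ?_) (IsCompact.union ?_ ?_)
  · exact (Finset.range _).isCompact_biUnion fun j _ => hA.image (f.continuous.iterate j)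
  · exact (Finset.range _).isCompact_biUnion fun j _ => hB.image (f.continuous.iterate j)
  · exact Finset.isCompact_biUnion _ fun j _ => isCompact_singleton
  · exact Finset.isCompact_biUnion _ fun j _ => isCompact_singleton

theorem sameOrbit_of_mem_localA {z : M} (h : z ∈ C.localA) :
    SameOrbit f z C.A ∨ SameOrbit f z C.Xm ∨ SameOrbit f z C.Ym := by
  rcases h with (rfl | ⟨k, rfl⟩) | (rfl | ⟨k, rfl⟩)
  · exact Or.inl (SameOrbit.refl f _)
  · exact Or.inr (Or.inl ((sameOrbit_iterate f _ _).trans (sameOrbit_iterate f _ _)))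
  · exact Or.inl (SameOrbit.refl f _)
  · exact Or.inr (Or.inr (sameOrbit_iterate_inverse (rightInverse_symm f) _ _))

theorem sameOrbit_of_mem_localB {z : M} (h : z ∈ C.localB) :
    SameOrbit f z C.B ∨ SameOrbit f z C.Xm ∨ SameOrbit f z C.Ym := by
  rcases h with (rfl | ⟨k, rfl⟩) | (rfl | ⟨k, rfl⟩)
  · exact Or.inl (SameOrbit.refl f _)
  · exact Or.inr (Or.inr ((sameOrbit_iterate f _ _).trans (sameOrbit_iterate f _ _)))
  · exact Or.inl (SameOrbit.refl f _)
  · exact Or.inr (Or.inl (sameOrbit_iterate_inverse (rightInverse_symm f) _ _))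

theorem mem_orbits_iff {z : M} : z ∈ C.orbits ↔
    ((SameOrbit f z C.A ∨ SameOrbit f z C.B) ∨ SameOrbit f z C.Xm) ∨ SameOrbit f z C.Ym := by
  have h : Injective f := f.injective
  simp only [orbits, Set.mem_union, mem_fullOrbit_iff h]

theorem eq_Yp_of_sameOrbit_Ym {C : SimpleCycle s u f} {W : Set M} (hW : W ∩ C.orbits = {C.Yp})
    {z : M} (h : SameOrbit f z C.Ym) (hz : z ∈ W) :
    z = f^[C.tab] C.Ym := by
  have h1 : z ∈ W ∩ C.orbits := ⟨hz, C.mem_orbits_iff.2 (by tauto)⟩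
  rw [hW] at h1
  exact h1

theorem puncturedOrbits_subset : C.puncturedOrbits ⊆ C.V₀ := by
  refine Set.Subset.trans (fun z hz => C.mem_orbits_iff.2 ?_) C.subset_V₀
  simp only [puncturedOrbits, Set.mem_union, Set.mem_iUnion, Set.mem_singleton_iff] at hz
  rcases hz with (⟨j, -, y, hy, rfl⟩ | ⟨j, -, y, hy, rfl⟩) | (⟨j, -, rfl⟩ | ⟨j, -, rfl⟩)
  · have := sameOrbit_iterate f j y
    rcases C.sameOrbit_of_mem_localA hy with h | h | h
    · exact Or.inl (Or.inl (Or.inl (this.trans h)))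
    · exact Or.inl (Or.inr (this.trans h))
    · exact Or.inr (this.trans h)
  · have := sameOrbit_iterate f j y
    rcases C.sameOrbit_of_mem_localB hy with h | h | h
    · exact Or.inl (Or.inl (Or.inr (this.trans h)))
    · exact Or.inl (Or.inr (this.trans h))
    · exact Or.inr (this.trans h)
  · exact Or.inl (Or.inr (sameOrbit_iterate f _ _))
  · exact Or.inr (sameOrbit_iterate f _ _)

end

theorem Xm_notMem_puncturedOrbits : C.Xm ∉ C.puncturedOrbits := by
  intro hz
  simp only [puncturedOrbits, Set.mem_union, Set.mem_iUnion, Set.mem_singleton_iff] at hz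
  rcases hz with (⟨j, hj, y, hy, h⟩ | ⟨j, hj, y, hy, h⟩) | (⟨j, hj, h⟩ | ⟨j, hj, h⟩)
  · rcases hy with (rfl | ⟨k, rfl⟩) | (rfl | ⟨k, rfl⟩)
    · exact C.not_sameOrbit_Xm_A ⟨0, j, h.symm⟩
    · simp only [← iterate_add_apply] at h
      exact C.Xm_not_periodic (by have := C.tba_pos; omega) h
    · exact C.not_sameOrbit_Xm_A ⟨0, j, h.symm⟩
    · refine C.not_sameOrbit_Xm_Ym ?_
      rw [← h]
      exact (sameOrbit_iterate f _ _).trans (sameOrbit_iterate_inverse (rightInverse_symm f) _ _)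
  · rcases hy with (rfl | ⟨k, rfl⟩) | (rfl | ⟨k, rfl⟩)
    · exact C.not_sameOrbit_Xm_B ⟨0, j, h.symm⟩
    · refine C.not_sameOrbit_Xm_Ym ?_
      rw [← h]
      exact (sameOrbit_iterate f _ _).trans
        ((sameOrbit_iterate f _ _).trans (sameOrbit_iterate f _ _))
    · exact C.not_sameOrbit_Xm_B ⟨0, j, h.symm⟩
    · have hj' : j < minimalPeriod f C.B * (k + 1) :=
        (Finset.mem_range.1 hj).trans_le (Nat.le_mul_of_pos_right _ k.succ_pos)
      exact C.Xm_not_periodic (Nat.sub_pos_of_lt hj') (iterate_of_iterate_symm hj'.le h)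
  · simp only [Finset.mem_sdiff, Finset.mem_singleton] at hj
    exact C.Xm_not_periodic (Nat.pos_of_ne_zero hj.2) h.symm
  · exact C.not_sameOrbit_Xm_Ym ⟨0, j, h⟩

section Neighborhoods

variable {C} {W : Set M} (hW : W ∩ C.orbits = {C.Yp})
include hW

theorem notMem_of_sameOrbit_A {z : M} (h : SameOrbit f z C.A) : z ∉ W := fun hz => by
  have h1 : z ∈ W ∩ C.orbits := ⟨hz, C.mem_orbits_iff.2 (by tauto)⟩
  rw [hW] at h1
  refine C.not_sameOrbit_Ym_A (SameOrbit.trans ?_ h)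
  rw [show z = f^[C.tab] C.Ym from h1]
  exact (sameOrbit_iterate f _ _).symm

theorem notMem_of_sameOrbit_B {z : M} (h : SameOrbit f z C.B) : z ∉ W := fun hz => by
  have h1 : z ∈ W ∩ C.orbits := ⟨hz, C.mem_orbits_iff.2 (by tauto)⟩
  rw [hW] at h1
  refine C.not_sameOrbit_Ym_B (SameOrbit.trans ?_ h)
  rw [show z = f^[C.tab] C.Ym from h1]
  exact (sameOrbit_iterate f _ _).symm

theorem notMem_of_sameOrbit_Xm {z : M} (h : SameOrbit f z C.Xm) : z ∉ W := fun hz => by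
  have h1 : z ∈ W ∩ C.orbits := ⟨hz, C.mem_orbits_iff.2 (by tauto)⟩
  rw [hW] at h1
  refine C.not_sameOrbit_Xm_Ym (SameOrbit.trans h.symm ?_)
  rw [show z = f^[C.tab] C.Ym from h1]
  exact sameOrbit_iterate f _ _

variable {V : Set M} (hV : C.puncturedOrbits ⊆ V)
include hV

/-- `W` meets the cycle only at `Y⁺`. Segments on the orbits of `A` and `X⁻` miss that point, and
those leading to `Y⁻` end before reaching it, since otherwise `Y⁻` would be periodic. -/
theorem localA_subset_goodSet : C.localA ⊆ C.chartA.goodSet V W := by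
  intro z hz
  have h1 : ∀ j < minimalPeriod f C.A, f^[j] z ∈ V := fun j hj => hV <| Or.inl <| Or.inl <|
    Set.mem_biUnion (Finset.mem_range.2 hj) ⟨z, hz, rfl⟩
  rcases hz with (rfl | ⟨k, rfl⟩) | (rfl | ⟨k, rfl⟩)
  on_goal 3 =>
    refine ⟨C.chartA.mem_source, ?_, fun j hj =>
      ⟨h1 j hj, notMem_of_sameOrbit_A hW (sameOrbit_iterate f _ _)⟩⟩
    rw [isPeriodicPt_minimalPeriod f C.A]
    exact C.chartA.mem_source
  · refine ⟨C.chartA.mem_source, ?_, fun j hj =>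
      ⟨h1 j hj, notMem_of_sameOrbit_A hW (sameOrbit_iterate f _ _)⟩⟩
    rw [isPeriodicPt_minimalPeriod f C.A]
    exact C.chartA.mem_source
  · refine ⟨C.Xp_mem.1 k, ?_, fun j hj => ⟨h1 j hj, notMem_of_sameOrbit_Xm hW
      ((sameOrbit_iterate f _ _).trans
        ((sameOrbit_iterate f _ _).trans (sameOrbit_iterate f _ _)))⟩⟩
    have := C.Xp_mem.1 (k + 1)
    rwa [iterate_mul_succ_apply] at this
  · refine ⟨C.Ym_mem.1 (k + 1), ?_, fun j hj => ⟨h1 j hj, fun hjW => ?_⟩⟩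
    · have := C.Ym_mem.1 k
      simp only
      rwa [iterate_mul_succ_apply, (rightInverse_symm f).iterate _ _]
    · have h2 := eq_Yp_of_sameOrbit_Ym hW ((sameOrbit_iterate f _ _).trans
        (sameOrbit_iterate_inverse (rightInverse_symm f) _ _)) hjW
      have hj' : j + 1 ≤ minimalPeriod f C.A * (k + 1) :=
        (Nat.succ_le_of_lt hj).trans (Nat.le_mul_of_pos_right _ k.succ_pos)
      have h3 := iterate_of_iterate_symm hj' h2
      rw [← iterate_add_apply] at h3
      exact C.Ym_not_periodic (by have := C.tab_pos; omega) h3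

theorem localB_subset_goodSet : C.localB ⊆ C.chartB.goodSet V W := by
  intro z hz
  have h1 : ∀ j < minimalPeriod f C.B, f^[j] z ∈ V := fun j hj => hV <| Or.inl <| Or.inr <|
    Set.mem_biUnion (Finset.mem_range.2 hj) ⟨z, hz, rfl⟩
  rcases hz with (rfl | ⟨k, rfl⟩) | (rfl | ⟨k, rfl⟩)
  on_goal 3 =>
    refine ⟨C.chartB.mem_source, ?_, fun j hj =>
      ⟨h1 j hj, notMem_of_sameOrbit_B hW (sameOrbit_iterate f _ _)⟩⟩
    rw [isPeriodicPt_minimalPeriod f C.B]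
    exact C.chartB.mem_source
  · refine ⟨C.chartB.mem_source, ?_, fun j hj =>
      ⟨h1 j hj, notMem_of_sameOrbit_B hW (sameOrbit_iterate f _ _)⟩⟩
    rw [isPeriodicPt_minimalPeriod f C.B]
    exact C.chartB.mem_source
  -- For `k = 0` the segment starts at `Y⁺ ∈ W`. This is harmless because `goodSet` tests `W` only
  -- on the iterates `j + 1`, and `Y⁺` never returns to itself.
  · refine ⟨C.Yp_mem.1 k, ?_, fun j hj => ⟨h1 j hj, fun hjW => ?_⟩⟩
    · have := C.Yp_mem.1 (k + 1)
      rwa [iterate_mul_succ_apply] at this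
    · have h2 := eq_Yp_of_sameOrbit_Ym hW ((sameOrbit_iterate f _ _).trans
        ((sameOrbit_iterate f _ _).trans (sameOrbit_iterate f _ _))) hjW
      rw [← iterate_add_apply f (j + 1)] at h2
      exact C.Yp_not_periodic (by omega) h2
  · refine ⟨C.Xm_mem.1 (k + 1), ?_, fun j hj => ⟨h1 j hj, notMem_of_sameOrbit_Xm hW
      ((sameOrbit_iterate f _ _).trans
        (sameOrbit_iterate_inverse (rightInverse_symm f) _ _))⟩⟩
    have := C.Xm_mem.1 k
    simp only
    rwa [iterate_mul_succ_apply, (rightInverse_symm f).iterate _ _]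

end Neighborhoods

/-- This set decides the least period: an orbit starting near `X⁻` whose intermediate iterates lie
in `V` cannot close up early. -/
theorem exists_open_superset : ∃ V : Set M, IsOpen V ∧ V ⊆ C.V₀ ∧ C.puncturedOrbits ⊆ V ∧
    ∀ᶠ z in 𝓝 C.Xm, z ∉ V := by
  obtain ⟨U₁, U₂, hU₁, hU₂, h1, h2, hd⟩ := SeparatedNhds.of_isCompact_isCompact
    C.isCompact_puncturedOrbits (isCompact_singleton (x := C.Xm))
    (Set.disjoint_singleton_right.2 C.Xm_notMem_puncturedOrbits)
  refine ⟨C.V₀ ∩ U₁, C.isOpen_V₀.inter hU₁, Set.inter_subset_left,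
    Set.subset_inter C.puncturedOrbits_subset h1, ?_⟩
  filter_upwards [hU₂.mem_nhds (h2 rfl)] with z hz hzV
  exact Set.disjoint_left.1 hd hzV.2 hz

end SimpleCycle

end HeteroCycle

namespace HeteroCycle

/-! ### Norm estimates for the strong blocks, index count, and the central multiplier. -/

section Estimates

variable {E : Type*} [NormedAddCommGroup E] [NormedSpace ℝ E]

/-- For the stable block of the return map, with `r = |λ_A|`: domination at `A` supplies the rate,
and at `B` mere contraction is enough. The next lemma is the unstable counterpart, for the inverse
block and `r = |λ_B|`. -/
theorem eventually_norm_lt_pow {a b : E →L[ℝ] E} (t t' : E →L[ℝ] E) {r : ℝ} (hr : 0 < r)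
    (ha : Tendsto (fun k : ℕ => (r⁻¹ • a) ^ k) atTop (𝓝 0))
    (hb : Tendsto (fun k : ℕ => b ^ k) atTop (𝓝 0)) :
    ∀ᶠ i : ℕ × ℕ in atTop, ‖b ^ i.2 * t * a ^ i.1 * t'‖ < r ^ i.1 := by
  have h := (((hb.comp tendsto_snd_atTop).mul (tendsto_const_nhds (x := t))).mul
    (ha.comp tendsto_fst_atTop)).mul (tendsto_const_nhds (x := t'))
  simp only [zero_mul] at h
  have h1 := h.norm.eventually_lt_const (u := 1) (by simp)
  filter_upwards [h1] with i hi
  simp only [comp_apply, smul_pow, mul_smul_comm, smul_mul_assoc, norm_smul] at hi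
  rw [Real.norm_of_nonneg (by positivity), inv_pow, inv_mul_lt_iff₀ (by positivity), mul_one] at hi
  exact hi

theorem eventually_norm_mul_pow_lt {a b : E →L[ℝ] E} (t t' : E →L[ℝ] E) {r : ℝ} (hr : 0 < r)
    (ha : Tendsto (fun k : ℕ => a ^ k) atTop (𝓝 0))
    (hb : Tendsto (fun k : ℕ => (r • b) ^ k) atTop (𝓝 0)) :
    ∀ᶠ i : ℕ × ℕ in atTop, ‖t * a ^ i.1 * t' * b ^ i.2‖ * r ^ i.2 < 1 := by
  have h := (((tendsto_const_nhds (x := t)).mul (ha.comp tendsto_fst_atTop)).mul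
    (tendsto_const_nhds (x := t'))).mul (hb.comp tendsto_snd_atTop)
  simp only [mul_zero, zero_mul] at h
  have h1 := h.norm.eventually_lt_const (u := 1) (by simp)
  filter_upwards [h1] with i hi
  simp only [comp_apply, smul_pow, mul_smul_comm, norm_smul] at hi
  rwa [Real.norm_of_nonneg (by positivity), mul_comm] at hi

end Estimates

section Index

theorem IsCentralMultiplier.card_filter {s u : ℕ} {Λ : Multiset ℂ} {μ : ℝ}
    (h : IsCentralMultiplier s Λ μ) (hΛ : Multiset.card Λ = s + 1 + u)
    [DecidablePred fun z : ℂ => 1 < ‖z‖] :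
    (|μ| < 1 → Multiset.card (Λ.filter fun z => 1 < ‖z‖) = u) ∧
    (1 < |μ| → Multiset.card (Λ.filter fun z => 1 < ‖z‖) = u + 1) := by
  obtain ⟨S, U, rfl, hS, hS', hU⟩ := h
  have hcU : Multiset.card U = u := by
    simp only [Multiset.card_add, Multiset.card_singleton, hS] at hΛ
    omega
  have h1 : S.filter (fun z : ℂ => 1 < ‖z‖) = 0 :=
    Multiset.filter_eq_nil.2 fun z hz => not_lt.2 (hS' z hz).2.le
  have h2 : U.filter (fun z : ℂ => 1 < ‖z‖) = U :=
    Multiset.filter_eq_self.2 fun z hz => (hU z hz).2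
  have h3 : ‖(μ : ℂ)‖ = |μ| := by simp
  constructor
  · intro hμ
    rw [Multiset.filter_add, Multiset.filter_add, h1, h2, Multiset.filter_singleton,
      if_neg (h3 ▸ not_lt.2 hμ.le)]
    simpa using hcU
  · intro hμ
    rw [Multiset.filter_add, Multiset.filter_add, h1, h2, Multiset.filter_singleton,
      if_pos (h3 ▸ hμ)]
    simp [hcU, add_comm]

variable {s u : ℕ} {M : Type*} [TopologicalSpace M]
  [ChartedSpace (EuclideanSpace ℝ (Fin (s + 1 + u))) M]

theorem card_multipliers (f : M → M) (p : M) :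
    Multiset.card (multipliers (d := s + 1 + u) f p) = s + 1 + u := by
  rw [multipliers, card_eigenvalues, finrank_euclideanSpace_fin]

theorem index_eq {f : M → M} {p : M} {μ : ℝ}
    (h : IsCentralMultiplier s (multipliers (d := s + 1 + u) f p) μ) :
    (|μ| < 1 → index (s + 1 + u) f p = u) ∧ (1 < |μ| → index (s + 1 + u) f p = u + 1) := by
  classical
  exact h.card_filter (card_multipliers f p)

theorem IsCentralMultiplier.mem {s : ℕ} {Λ : Multiset ℂ} {μ : ℝ} (h : IsCentralMultiplier s Λ μ) :
    (μ : ℂ) ∈ Λ := by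
  obtain ⟨S, U, rfl, -⟩ := h
  simp

end Index

namespace LinearizingChart

variable {s u : ℕ} {M : Type*} [TopologicalSpace M]
  [ChartedSpace (EuclideanSpace ℝ (Fin (s + 1 + u))) M]

/-- If `lam` vanished, the return map would send a short piece of the central axis to `p`, against
injectivity. -/
theorem lam_ne_zero {f : M → M} {p : M} (c : LinearizingChart (s := s) (u := u) f p)
    (hf : Continuous f) (hinj : Injective f) : c.lam ≠ 0 := by
  intro h0
  have hp : f^[minimalPeriod f p] p = p := isPeriodicPt_minimalPeriod f p
  have h0t : (0 : Coord s u) ∈ c.chart.target := c.map_center ▸ c.chart.map_source c.mem_source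
  have hsymm : c.chart.symm 0 = p := by rw [← c.map_center, c.chart.left_inv c.mem_source]
  have hι : Continuous fun t : ℝ => ((0, t, 0) : Coord s u) := by fun_prop
  have h1 : Tendsto (fun t : ℝ => c.chart.symm (0, t, 0)) (𝓝 0) (𝓝 p) := by
    have := (c.chart.continuousAt_symm h0t).tendsto.comp (hι.tendsto 0)
    rwa [hsymm] at this
  have h2 : Tendsto (fun t : ℝ => f^[minimalPeriod f p] (c.chart.symm (0, t, 0))) (𝓝 0) (𝓝 p) := by
    have := ((hf.iterate (minimalPeriod f p)).tendsto p).comp h1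
    rwa [hp] at this
  have h3 := (h2.eventually (c.chart.open_source.mem_nhds c.mem_source)).and
    ((hι.tendsto 0).eventually (c.chart.open_target.mem_nhds h0t))
  obtain ⟨t, ⟨ht1, ht2⟩, ht0⟩ := ((h3.filter_mono nhdsWithin_le_nhds).and
    (self_mem_nhdsWithin : ∀ᶠ t : ℝ in 𝓝[≠] 0, t ∈ ({0}ᶜ : Set ℝ))).exists
  have h4 := c.linear _ (c.chart.map_target ht2) ht1
  rw [c.chart.right_inv ht2, h0] at h4
  have h5 : c.chart (f^[minimalPeriod f p] (c.chart.symm (0, t, 0))) = c.chart p := by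
    rw [h4, c.map_center]; simp
  have h6 := c.chart.injOn ht1 c.mem_source h5
  have h7 := hinj.iterate _ (h6.trans hp.symm)
  have h8 := congrArg c.chart h7
  rw [c.chart.right_inv ht2, c.map_center] at h8
  exact ht0 (congrArg (fun x : Coord s u => x.2.1) h8)

theorem isCentralMultiplier_lam
    {f : Diffeomorph (𝓡 (s + 1 + u)) (𝓡 (s + 1 + u)) M M 1} {p : M}
    (c : LinearizingChart (s := s) (u := u) f p) :
    IsCentralMultiplier s (multipliers (d := s + 1 + u) f p) c.lam := by
  have h := multipliers_eq f c.contMDiffOn_chart c.contMDiffOn_symm c.mem_source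
    (c.L.hasFDerivAt (x := c.chart p)) ?_
  · rw [h, L, eigenvalues_block]
    refine ⟨_, _, rfl, ?_, c.strong_stable, c.strong_unstable⟩
    rw [card_eigenvalues, finrank_euclideanSpace_fin]
  · have h1 : f^[minimalPeriod f p] p ∈ c.chart.source := by
      rw [isPeriodicPt_minimalPeriod f p]; exact c.mem_source
    filter_upwards [c.chart.open_source.mem_nhds c.mem_source,
      (c.chart.open_source.preimage (f.continuous.iterate (minimalPeriod f p))).mem_nhds h1]
      with z hz hz'
    exact c.chart_iterate hz hz'

end LinearizingChart

/-! ### Transitions and their persistence under the unfolding. -/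

namespace AffineTransition

variable {s u : ℕ} (T : AffineTransition s u)

/-- The factor `±1` of the central isometry. -/
noncomputable def sign : ℝ := T.Tc.linearIsometry 1

theorem abs_sign : |T.sign| = 1 := by
  rw [sign, ← Real.norm_eq_abs, LinearIsometry.norm_map]
  simp

theorem Tc_apply (x : ℝ) : T.Tc x = T.sign * x + T.Tc 0 := by
  have h := T.Tc.map_vadd 0 x
  have h2 : T.Tc.linearIsometry x = x * T.Tc.linearIsometry 1 := by
    simpa using T.Tc.linearIsometry.map_smul x 1
  simp only [vadd_eq_add, add_zero] at h
  rw [h, h2, sign, mul_comm]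

/-- The linear part of the strong unstable component. -/
noncomputable def tu : EuclideanSpace ℝ (Fin u) ≃L[ℝ] EuclideanSpace ℝ (Fin u) :=
  T.Tu.linear.toContinuousLinearEquiv

/-- The linear part of the strong stable component. -/
noncomputable def ts : EuclideanSpace ℝ (Fin s) →L[ℝ] EuclideanSpace ℝ (Fin s) :=
  LinearMap.toContinuousLinearMap T.Ts.linear

/-- The linear part of a transition. -/
noncomputable def deriv : Coord s u →L[ℝ] Coord s u :=
  block T.ts T.sign (T.tu : EuclideanSpace ℝ (Fin u) →L[ℝ] EuclideanSpace ℝ (Fin u))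

theorem toFun_eq (x : Coord s u) : T.toFun x = T.deriv x + T.toFun 0 := by
  have h1 : T.Ts x.1 = T.Ts.linear x.1 + T.Ts 0 := by simpa using T.Ts.map_vadd 0 x.1
  have h2 : T.Tu x.2.2 = T.Tu.linear x.2.2 + T.Tu 0 := by simpa using T.Tu.map_vadd 0 x.2.2
  refine Prod.ext h1 (Prod.ext (T.Tc_apply x.2.1) h2)

theorem hasFDerivAt (x : Coord s u) : HasFDerivAt T.toFun T.deriv x := by
  have h : T.toFun = fun x => T.deriv x + T.toFun 0 := funext T.toFun_eq
  rw [h]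
  exact T.deriv.hasFDerivAt.add_const _

theorem continuous : Continuous T.toFun :=
  continuous_iff_continuousAt.2 fun x => (T.hasFDerivAt x).continuousAt

end AffineTransition

namespace Unfolding

variable {s u : ℕ} {M : Type*} [TopologicalSpace M]
  [ChartedSpace (EuclideanSpace ℝ (Fin (s + 1 + u))) M] [IsManifold (𝓡 (s + 1 + u)) 1 M]
  {f : Diffeomorph (𝓡 (s + 1 + u)) (𝓡 (s + 1 + u)) M M 1} {C : SimpleCycle s u f}
  (F : Unfolding C)

/-- Restrict the `C¹` convergence to the zero section of the tangent bundle and project to `M`. -/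
theorem continuousAt_map (x : M) : ContinuousAt (fun q : ℝ × M => F.map q.1 q.2) (0, x) := by
  let σ : M → TangentBundle (𝓡 (s + 1 + u)) M :=
    Bundle.zeroSection (EuclideanSpace ℝ (Fin (s + 1 + u))) (TangentSpace (𝓡 (s + 1 + u)) (M := M))
  have hσ : Continuous σ :=
    (Bundle.contMDiff_zeroSection (n := 1) (IB := 𝓡 (s + 1 + u)) ℝ
      (TangentSpace (𝓡 (s + 1 + u)) (M := M))).continuous
  have h1 : ContinuousAt (fun q : ℝ × M => (q.1, σ q.2)) (0, x) := by fun_prop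
  have h2 := (F.tendsto_C1 (σ x)).comp_of_eq (f := fun q : ℝ × M => (q.1, σ q.2)) h1 rfl
  exact (FiberBundle.continuous_proj (EuclideanSpace ℝ (Fin (s + 1 + u)))
    (TangentSpace (𝓡 (s + 1 + u)) (M := M))).continuousAt.comp h2

theorem continuousAt_iterate (x : M) (n : ℕ) :
    ContinuousAt (fun q : ℝ × M => (F.map q.1)^[n] q.2) (0, x) := by
  induction n with
  | zero => exact continuousAt_snd
  | succ n ih =>
    simp only [iterate_succ_apply']
    exact (F.continuousAt_map ((F.map 0)^[n] x)).comp_of_eq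
      (f := fun q : ℝ × M => (q.1, (F.map q.1)^[n] q.2)) (continuousAt_fst.prodMk ih) rfl

/-- This segment ends in `W`, where `f_ν` may differ from `f`. Its position in `V` is therefore
obtained from joint continuity in `(ν, x)` at `(0, Y⁻)`. -/
theorem eventually_segment_Ym {V : Set M} (hV : IsOpen V) (hCV : ∀ j < C.tab, f^[j] C.Ym ∈ V) :
    ∀ᶠ q : ℝ × M in 𝓝 (0, C.Ym), Segment V C.chartA.chart C.chartB.chart (F.map q.1) C.tab
      (fun x => C.Tab.toFun x + (0, q.1, 0)) q.2 := by
  have h1 : ∀ᶠ q : ℝ × M in 𝓝 (0, C.Ym), ∀ j ∈ Finset.range C.tab, (F.map q.1)^[j] q.2 ∈ V := by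
    rw [Filter.eventually_all_finset]
    intro j hj
    refine (F.continuousAt_iterate C.Ym j).eventually (hV.mem_nhds ?_)
    simp only [F.map_zero]
    exact hCV j (Finset.mem_range.1 hj)
  have hsrc : C.Ym ∈ C.chartA.chart.source := by simpa using C.Ym_mem.1 0
  have h2 : ∀ᶠ q : ℝ × M in 𝓝 (0, C.Ym), ∀ᶠ z in 𝓝 q.2, ∀ ν : ℝ, |ν| < F.ν₀ →
      z ∈ C.chartA.chart.source ∧ (F.map ν)^[C.tab] z ∈ C.chartB.chart.source ∧
      C.chartB.chart ((F.map ν)^[C.tab] z) = C.Tab.toFun (C.chartA.chart z) + (0, ν, 0) := by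
    refine (continuous_snd.tendsto ((0 : ℝ), C.Ym)).eventually (eventually_eventually_nhds.2 ?_)
    filter_upwards [F.transition, C.Tab_eq, C.chartA.chart.open_source.mem_nhds hsrc]
      with z hz hz' hz'' ν hν
    exact ⟨hz'', (hz ν hν).1, by rw [(hz ν hν).2, hz'.2]⟩
  have h3 : ∀ᶠ q : ℝ × M in 𝓝 (0, C.Ym), |q.1| < F.ν₀ :=
    (continuous_abs.comp continuous_fst).continuousAt.eventually_lt continuousAt_const
      (by simpa using F.ν₀_pos)
  filter_upwards [h1, h2, h3] with q hq1 hq2 hq3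
  exact ⟨fun j hj => hq1 j (Finset.mem_range.2 hj), hq2.mono fun z hz => hz q.1 hq3⟩

/-- The orbit of `X⁻` misses the closed set `W`, so along this transition `f_ν = f` near `X⁻`,
uniformly in `ν`. Time `0` is excluded because `V` is going to miss `X⁻`. -/
theorem eventually_conj_Xm [T2Space M] {V : Set M} (hV : IsOpen V)
    (hCV : ∀ j, 0 < j → j < C.tba → f^[j] C.Xm ∈ V) :
    ∀ᶠ x in 𝓝 C.Xm, ∀ ν : ℝ, |ν| < F.ν₀ →
      (∀ j, 0 < j → j < C.tba → (F.map ν)^[j] x ∈ V) ∧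
      ∀ᶠ z in 𝓝 x, z ∈ C.chartB.chart.source ∧ (F.map ν)^[C.tba] z ∈ C.chartA.chart.source ∧
        C.chartA.chart ((F.map ν)^[C.tba] z) = C.Tba.toFun (C.chartB.chart z) := by
  have hsrc : C.Xm ∈ C.chartB.chart.source := by simpa using C.Xm_mem.1 0
  have h1 : ∀ᶠ x in 𝓝 C.Xm, ∀ j ∈ Finset.range C.tba, f^[j + 1] x ∉ F.W := by
    rw [Filter.eventually_all_finset]
    intro j _
    exact ((f.continuous.iterate (j + 1)).tendsto C.Xm).eventually
      (F.isClosed_W.isOpen_compl.mem_nhds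
        (SimpleCycle.notMem_of_sameOrbit_Xm F.W_inter_orbits (sameOrbit_iterate f _ _)))
  have h2 : ∀ᶠ x in 𝓝 C.Xm, ∀ j ∈ Finset.range C.tba, 0 < j → f^[j] x ∈ V := by
    rw [Filter.eventually_all_finset]
    intro j hj
    rcases Nat.eq_zero_or_pos j with rfl | hj0
    · simp
    · exact (((f.continuous.iterate j).tendsto C.Xm).eventually
        (hV.mem_nhds (hCV j hj0 (Finset.mem_range.1 hj)))).mono fun _ h _ => h
  have hit : ∀ x, (∀ j ∈ Finset.range C.tba, f^[j + 1] x ∉ F.W) → ∀ ν : ℝ, |ν| < F.ν₀ →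
      ∀ j ≤ C.tba, (F.map ν)^[j] x = f^[j] x := fun x hx ν hν j hj =>
    iterate_eq_of_avoid (F.eq_off ν hν) (fun i hi => hx i (Finset.mem_range.2 hi)) hj
  have h3 : ∀ᶠ x in 𝓝 C.Xm, ∀ ν : ℝ, |ν| < F.ν₀ →
      x ∈ C.chartB.chart.source ∧ (F.map ν)^[C.tba] x ∈ C.chartA.chart.source ∧
        C.chartA.chart ((F.map ν)^[C.tba] x) = C.Tba.toFun (C.chartB.chart x) := by
    filter_upwards [h1, C.Tba_eq, C.chartB.chart.open_source.mem_nhds hsrc] with x hx hx' hx'' ν hν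
    rw [hit x hx ν hν _ le_rfl]
    exact ⟨hx'', hx'⟩
  filter_upwards [h1, h2, eventually_eventually_nhds.2 h3] with x hx1 hx2 hx3 ν hν
  refine ⟨fun j hj0 hj => ?_, hx3.mono fun z hz => hz ν hν⟩
  rw [hit x hx1 ν hν j hj.le]
  exact hx2 j (Finset.mem_range.2 hj) hj0

end Unfolding

end HeteroCycle

/-! ### Construction of the periodic orbits. -/

namespace HeteroCycle

theorem pow_apply {E : Type*} [NormedAddCommGroup E] [NormedSpace ℝ E] (T : E →L[ℝ] E) (k : ℕ)
    (x : E) : (T ^ k) x = T^[k] x := by simp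

namespace LinearizingChart

variable {s u : ℕ} {M : Type*} [TopologicalSpace M]
  [ChartedSpace (EuclideanSpace ℝ (Fin (s + 1 + u))) M] {f : M → M} {p : M}
  (c : LinearizingChart (s := s) (u := u) f p)

/-- The strong stable block. -/
noncomputable def stable : EuclideanSpace ℝ (Fin s) →L[ℝ] EuclideanSpace ℝ (Fin s) :=
  LinearMap.toContinuousLinearMap c.Ls

/-- The strong unstable block. -/
noncomputable def unstable : EuclideanSpace ℝ (Fin u) →L[ℝ] EuclideanSpace ℝ (Fin u) :=
  LinearMap.toContinuousLinearMap c.Lu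

theorem L_eq : c.L = block c.stable c.lam c.unstable := rfl

theorem tendsto_stable_pow : Tendsto (fun k : ℕ => c.stable ^ k) atTop (𝓝 0) := by
  have := tendsto_pow_of_eigenvalues_lt (L := c.stable) one_pos fun z hz =>
    (c.strong_stable z hz).2
  simpa using this

theorem tendsto_stable_pow_smul (h : c.lam ≠ 0) :
    Tendsto (fun k : ℕ => (|c.lam|⁻¹ • c.stable) ^ k) atTop (𝓝 0) :=
  tendsto_pow_of_eigenvalues_lt (L := c.stable) (abs_pos.2 h) fun z hz => (c.strong_stable z hz).1

theorem exists_unstable_inverse (h : c.lam ≠ 0) :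
    ∃ b : EuclideanSpace ℝ (Fin u) →L[ℝ] EuclideanSpace ℝ (Fin u),
      (∀ x, c.unstable (b x) = x) ∧ (∀ x, b (c.unstable x) = x) ∧
      Tendsto (fun k : ℕ => b ^ k) atTop (𝓝 0) ∧
      Tendsto (fun k : ℕ => (|c.lam| • b) ^ k) atTop (𝓝 0) := by
  obtain ⟨b, h1, h2⟩ := exists_inverse_of_lt_eigenvalues (L := c.unstable) zero_le_one
    fun z hz => (c.strong_unstable z hz).2
  refine ⟨b, h1, h2, ?_, ?_⟩
  · have := tendsto_inverse_pow_of_lt_eigenvalues (L := c.unstable) one_pos h1 h2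
      fun z hz => (c.strong_unstable z hz).2
    simpa using this
  · exact tendsto_inverse_pow_of_lt_eigenvalues (L := c.unstable) (abs_pos.2 h) h1 h2
      fun z hz => (c.strong_unstable z hz).1

end LinearizingChart

namespace Unfolding

variable {s u : ℕ} {M : Type*} [TopologicalSpace M] [T2Space M]
  [ChartedSpace (EuclideanSpace ℝ (Fin (s + 1 + u))) M] [IsManifold (𝓡 (s + 1 + u)) 1 M]
  {f : Diffeomorph (𝓡 (s + 1 + u)) (𝓡 (s + 1 + u)) M M 1} {C : SimpleCycle s u f}
  (F : Unfolding C)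

/-- The length of the itinerary with `l` returns near `A` and `m` returns near `B`. -/
noncomputable def _root_.HeteroCycle.SimpleCycle.length (C : SimpleCycle s u f) (i : ℕ × ℕ) : ℕ :=
  (i.2 * minimalPeriod f C.B + (C.tab + i.1 * minimalPeriod f C.A)) + C.tba

/-- The composition of linear maps and transitions along the itinerary with `l` returns near `A`
and `m` returns near `B`, for the parameter `ν`. -/
noncomputable def _root_.HeteroCycle.SimpleCycle.itinerary (C : SimpleCycle s u f) (ν : ℝ)
    (i : ℕ × ℕ) : Coord s u → Coord s u :=
  (C.chartB.L^[i.2] ∘ (fun x => C.Tab.toFun x + (0, ν, 0)) ∘ C.chartA.L^[i.1]) ∘ C.Tba.toFun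

theorem exists_periodic_orbits {V : Set M} (hVo : IsOpen V) (hVp : C.puncturedOrbits ⊆ V) :
    (C.chartB.chart C.Xm).1 = 0 ∧
    ∃ (ν : ℕ × ℕ → ℝ) (R : ℕ × ℕ → M), Tendsto ν atTop (𝓝 0) ∧ Tendsto R atTop (𝓝 C.Xm) ∧
      Tendsto (fun i => C.chartB.chart (R i)) atTop (𝓝 (C.chartB.chart C.Xm)) ∧
      ∀ᶠ i in atTop, |ν i| < F.ν₀ ∧ R i ∈ C.chartB.chart.source ∧
        (C.chartB.chart (R i)).2.1 = (C.chartB.chart C.Xm).2.1 ∧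
        (∀ j, 0 < j → j < C.length i → (F.map (ν i))^[j] (R i) ∈ V) ∧
        (F.map (ν i))^[C.length i] (R i) = R i ∧
        ∀ᶠ z in 𝓝 (R i), C.chartB.chart ((F.map (ν i))^[C.length i] z) =
          C.itinerary (ν i) i (C.chartB.chart z) := by
  have hlA := C.chartA.lam_ne_zero f.continuous f.injective
  have hlB := C.chartB.lam_ne_zero f.continuous f.injective
  obtain ⟨bA, hA1, hA2, hbA, -⟩ := C.chartA.exists_unstable_inverse hlA
  obtain ⟨bB, hB1, hB2, hbB, -⟩ := C.chartB.exists_unstable_inverse hlB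
  have haA := C.chartA.tendsto_stable_pow
  have haB := C.chartB.tendsto_stable_pow
  let SA : HyperbolicSplitting C.chartA.L :=
    splittingOfContracting haA C.central_A hbA hA1 hA2
  let SB : HyperbolicSplitting C.chartB.L :=
    splittingOfExpanding haB C.central_B hbB hB1 hB2
  have SAP : ∀ k x, SA.P k x = ((C.chartA.stable ^ k) x.1, C.chartA.lam ^ k * x.2.1, 0) :=
    fun _ _ => rfl
  have SAQ : ∀ k x, SA.Q k x = (0, 0, (bA ^ k) x.2.2) := fun k x =>
    Prod.ext rfl (Prod.ext (zero_mul _) rfl)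
  have SBP : ∀ k x, SB.P k x = ((C.chartB.stable ^ k) x.1, 0, 0) := fun k x =>
    Prod.ext rfl (Prod.ext (zero_mul _) rfl)
  have SBQ : ∀ k x, SB.Q k x = (0, C.chartB.lam⁻¹ ^ k * x.2.1, (bB ^ k) x.2.2) := fun _ _ => rfl
  set X := C.chartB.chart C.Xm with hX
  set Y := C.chartA.chart C.Ym with hY
  have hXp : C.chartA.chart (f^[C.tba] C.Xm) = C.Tba.toFun X := C.Tba_eq.self_of_nhds.2
  have hYp : C.chartB.chart (f^[C.tab] C.Ym) = C.Tab.toFun Y := C.Tab_eq.self_of_nhds.2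
  have hXs : C.Xm ∈ C.chartB.chart.source := by simpa using C.Xm_mem.1 0
  have hYs : C.Ym ∈ C.chartA.chart.source := by simpa using C.Ym_mem.1 0
  have hri : RightInverse f.symm f := f.apply_symm_apply
  -- the coordinates of the heteroclinic points
  have hX1 : X.1 = 0 := by
    have := C.chartB.P_chart_of_mem_unstable SB hri C.Xm_mem
    simpa using congrArg Prod.fst ((SBP 0 X).symm.trans this)
  have hYP := C.chartA.P_chart_of_mem_unstable SA hri C.Ym_mem
  have hY1 : Y.1 = 0 := by
    simpa using congrArg Prod.fst ((SAP 0 Y).symm.trans hYP)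
  have hY2 : Y.2.1 = 0 := by
    simpa using congrArg (fun x => x.2.1) ((SAP 0 Y).symm.trans hYP)
  have hXu : C.Tba.Tu X.2.2 = 0 := by
    have := C.chartA.Q_chart_of_mem_stable SA C.Xp_mem
    rw [hXp, SAQ] at this
    simpa [AffineTransition.toFun] using congrArg (fun x => x.2.2) this
  have hYu : C.Tab.Tu Y.2.2 = 0 := by
    have := C.chartB.Q_chart_of_mem_stable SB C.Yp_mem
    rw [hYp, SBQ] at this
    simpa [AffineTransition.toFun] using congrArg (fun x => x.2.2) this
  have hXu' : C.Tba.Tu.symm 0 = X.2.2 := by rw [← hXu, AffineEquiv.symm_apply_apply]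
  have hYu' : C.Tab.Tu.symm 0 = Y.2.2 := by rw [← hYu, AffineEquiv.symm_apply_apply]
  refine ⟨hX1, ?_⟩
  -- the fixed points in the strong directions
  obtain ⟨y, hy, hyfix⟩ := exists_fixedPoints_affine C.Tab.Ts C.Tba.Ts haA haB
  obtain ⟨v, hv, hvfix⟩ := exists_fixedPoints_affine (C.Tba.Tu.symm : _ →ᵃ[ℝ] _)
    (C.Tab.Tu.symm : _ →ᵃ[ℝ] _) hbA hbB
  have hv : Tendsto v atTop (𝓝 X.2.2) := by rw [← hXu']; exact hv
  -- The solution of `λ_B^m (T_ab^c (λ_A^l T_ba^c c) + ν) = c`, where `c` is the central coordinate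
  -- of `X⁻`.
  let ν : ℕ × ℕ → ℝ := fun i =>
    C.chartB.lam⁻¹ ^ i.2 * X.2.1 - C.Tab.Tc (C.chartA.lam ^ i.1 * C.Tba.Tc X.2.1)
  -- `w` holds the coordinates of `R`. The stable fixed point `y` lives at the arrival near `Y⁺`, so
  -- it is carried through `m` returns near `B`; the unstable one `v` already lives near `X⁻`.
  let w : ℕ × ℕ → Coord s u := fun i => ((C.chartB.stable ^ i.2) (y i), X.2.1, v i)
  let R : ℕ × ℕ → M := fun i => C.chartB.chart.symm (w i)
  -- `q` is the unstable coordinate on leaving `A`, pulled back from `v`. Below, `e` is the exit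
  -- point near `Y⁻`, `b` its unstable part, and `a'` the stable part of the arrival point near
  -- `Y⁺`.
  let q : ℕ × ℕ → EuclideanSpace ℝ (Fin u) := fun i => C.Tab.Tu.symm ((bB ^ i.2) (v i))
  let b : ℕ × ℕ → Coord s u := fun i => (0, 0, q i)
  let e : ℕ × ℕ → Coord s u := fun i => SA.P i.1 (C.Tba.toFun (w i)) + SA.Q 0 (b i)
  let a' : ℕ × ℕ → Coord s u := fun i => (y i, 0, 0)
  have hν : Tendsto ν atTop (𝓝 0) := by
    have h1 : Tendsto (fun i : ℕ × ℕ => C.chartB.lam⁻¹ ^ i.2 * X.2.1) atTop (𝓝 0) := by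
      have := (tendsto_pow_atTop_nhds_zero_of_abs_lt_one
        (by rw [abs_inv]; exact inv_lt_one_of_one_lt₀ C.central_B)).comp tendsto_snd_atTop
      simpa using this.mul_const X.2.1
    have h2 : Tendsto (fun i : ℕ × ℕ => C.chartA.lam ^ i.1 * C.Tba.Tc X.2.1) atTop (𝓝 0) := by
      have := (tendsto_pow_atTop_nhds_zero_of_abs_lt_one C.central_A).comp tendsto_fst_atTop
      simpa using this.mul_const (C.Tba.Tc X.2.1)
    have h3 := (C.Tab.Tc.continuous.tendsto 0).comp h2
    rw [C.Tab_central_linear] at h3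
    simpa [ν, Function.comp_def] using h1.sub h3
  have hw : Tendsto w atTop (𝓝 X) := by
    have h1 := tendsto_clm_apply (haB.comp tendsto_snd_atTop) hy
    have h2 : X = (0, X.2.1, X.2.2) := Prod.ext hX1 rfl
    rw [h2]
    exact (by simpa using h1 : Tendsto _ _ (𝓝 _)).prodMk_nhds (tendsto_const_nhds.prodMk_nhds hv)
  have hR : Tendsto R atTop (𝓝 C.Xm) := by
    have := (C.chartB.chart.continuousAt_symm (C.chartB.chart.map_source hXs)).tendsto.comp hw
    rwa [C.chartB.chart.left_inv hXs] at this
  have hwt : ∀ᶠ i in atTop, w i ∈ C.chartB.chart.target :=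
    hw.eventually (C.chartB.chart.open_target.mem_nhds (C.chartB.chart.map_source hXs))
  have hp : Tendsto (fun i => C.Tba.toFun (w i)) atTop (𝓝 (C.chartA.chart (f^[C.tba] C.Xm))) := by
    rw [hXp]
    exact (C.Tba.continuous.tendsto X).comp hw
  have hq : Tendsto q atTop (𝓝 Y.2.2) := by
    have h1 := tendsto_clm_apply (hbB.comp tendsto_snd_atTop) hv
    have h2 : Continuous C.Tab.Tu.symm :=
      AffineMap.continuous_of_finiteDimensional C.Tab.Tu.symm.toAffineMap
    rw [zero_apply] at h1
    rw [← hYu']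
    exact (h2.tendsto 0).comp h1
  have hb : Tendsto b atTop (𝓝 Y) := by
    have h2 : Y = (0, 0, Y.2.2) := Prod.ext hY1 (Prod.ext hY2 rfl)
    rw [h2]
    exact tendsto_const_nhds.prodMk_nhds (tendsto_const_nhds.prodMk_nhds hq)
  have he : Tendsto e atTop (𝓝 Y) := by
    have h1 := tendsto_clm_apply (SA.tendsto_P.comp tendsto_fst_atTop) hp
    have h2 := ((SA.Q 0).continuous.tendsto Y).comp hb
    have := h1.add h2
    rw [SA.Q_eq_of_P hYP] at this
    simpa using this
  have ha' : Tendsto a' atTop (𝓝 (C.chartB.chart (f^[C.tab] C.Ym))) := by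
    have h1 := SB.P_eq_of_Q (C.chartB.Q_chart_of_mem_stable SB C.Yp_mem)
    rw [hYp, SBP] at h1
    rw [hYp, ← h1]
    have h2 : (C.Tab.toFun Y).1 = C.Tab.Ts 0 := by rw [← hY1]; rfl
    rw [h2]
    exact hy.prodMk_nhds tendsto_const_nhds
  have hZ : Tendsto (fun i => (ν i, C.chartA.chart.symm (e i))) atTop (𝓝 (0, C.Ym)) := by
    have := (C.chartA.chart.continuousAt_symm (C.chartA.chart.map_source hYs)).tendsto.comp he
    rw [C.chartA.chart.left_inv hYs] at this
    exact hν.prodMk_nhds this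
  -- the orbit segments
  have hGA := SimpleCycle.localA_subset_goodSet F.W_inter_orbits hVp
  have hGB := SimpleCycle.localB_subset_goodSet F.W_inter_orbits hVp
  obtain ⟨δA, hδA, NA, hsegA⟩ := C.chartA.exists_segments SA f.continuous hri V F.W hVo
    F.isClosed_W (hGA (Or.inl (Or.inl rfl))) C.Xp_mem C.Ym_mem
    (fun k => hGA (Or.inl (Or.inr ⟨k, rfl⟩))) (fun k => hGA (Or.inr (Or.inr ⟨k, rfl⟩)))
  obtain ⟨δB, hδB, NB, hsegB⟩ := C.chartB.exists_segments SB f.continuous hri V F.W hVo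
    F.isClosed_W (hGB (Or.inl (Or.inl rfl))) C.Yp_mem C.Xm_mem
    (fun k => hGB (Or.inl (Or.inr ⟨k, rfl⟩))) (fun k => hGB (Or.inr (Or.inr ⟨k, rfl⟩)))
  have hXmV : ∀ j, 0 < j → j < C.tba → f^[j] C.Xm ∈ V := fun j hj0 hj => hVp <| Or.inr <| Or.inl <|
    Set.mem_biUnion (by simpa using ⟨hj, hj0.ne'⟩) rfl
  have hYmV : ∀ j < C.tab, f^[j] C.Ym ∈ V := fun j hj => hVp <| Or.inr <| Or.inr <|
    Set.mem_biUnion (Finset.mem_range.2 hj) rfl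
  have hRw : ∀ i, w i ∈ C.chartB.chart.target → C.chartB.chart (R i) = w i := fun i hi =>
    C.chartB.chart.right_inv hi
  refine ⟨ν, R, hν, hR, hw.congr' (hwt.mono fun i hi => (hRw i hi).symm), ?_⟩
  filter_upwards [hwt, hyfix, hvfix,
    hν.abs.eventually_lt_const (by simpa using F.ν₀_pos),
    hR.eventually (F.eventually_conj_Xm hVo hXmV),
    hp.eventually (Metric.ball_mem_nhds _ hδA), hb.eventually (Metric.ball_mem_nhds _ hδA),
    tendsto_fst_atTop.eventually_ge_atTop NA, hZ.eventually (F.eventually_segment_Ym hVo hYmV),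
    ha'.eventually (Metric.ball_mem_nhds _ hδB), hw.eventually (Metric.ball_mem_nhds _ hδB),
    tendsto_snd_atTop.eventually_ge_atTop NB]
    with i hwi hyi hvi hνi hconj hpi hbi hil hsegY ha'i hwi' him
  have hRs : R i ∈ C.chartB.chart.source := C.chartB.chart.map_target hwi
  obtain ⟨hV1, hconj1⟩ := hconj (ν i) hνi
  set g := F.map (ν i) with hg
  have hgc : Continuous g := g.continuous
  have hoff := F.eq_off (ν i) hνi
  have h1 := hconj1.self_of_nhds
  rw [hRw i hwi] at h1
  -- The fixed-point equation for `v` says that the unstable coordinate on arrival near `A` is the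
  -- `l`-fold contraction of `q`, which is the form required by `exists_segments`.
  have hPQ : C.Tba.toFun (w i) = SA.P 0 (C.Tba.toFun (w i)) + SA.Q i.1 (b i) := by
    rw [SAP, SAQ]
    refine Prod.ext ?_ (Prod.ext ?_ ?_)
    · simp
    · simp
    · have : C.Tba.Tu (v i) = (bA ^ i.1) (q i) := by
        rw [hvi]
        exact C.Tba.Tu.apply_symm_apply _
      simpa [AffineTransition.toFun, w, b] using this
  have seg2 := hsegA i.1 hil _ _ hpi hbi g hgc hoff _ h1.2.1 (h1.2.2.trans hPQ)
  have hend2 : C.chartA.chart (g^[i.1 * minimalPeriod f C.A] (g^[C.tba] (R i))) = e i := by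
    rw [seg2.end_eq, h1.2.2, hPQ, ← pow_apply, SA.pow_add le_rfl, Nat.sub_self]
  have hZi : C.chartA.chart.symm (e i) = g^[i.1 * minimalPeriod f C.A] (g^[C.tba] (R i)) := by
    rw [← hend2, C.chartA.chart.left_inv seg2.end_mem]
  rw [hZi] at hsegY
  have seg3 := seg2.comp hgc hsegY
  have hend3 : C.chartB.chart (g^[C.tab + i.1 * minimalPeriod f C.A] (g^[C.tba] (R i))) =
      SB.P 0 (a' i) + SB.Q i.2 (w i) := by
    rw [iterate_add_apply, hsegY.end_eq, hend2, SBP, SBQ]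
    simp only [e, SAP, SAQ]
    -- The three coordinates use respectively the equation for `y`, the choice of `ν`, and the
    -- definition of `q`.
    refine Prod.ext ?_ (Prod.ext ?_ ?_)
    · simpa [AffineTransition.toFun, w, a'] using hyi.symm
    · simp [AffineTransition.toFun, w, ν]
    · simp [AffineTransition.toFun, w, b, q]
  have seg4 := hsegB i.2 him _ _ ha'i hwi' g hgc hoff _ seg3.end_mem hend3
  have hend4 : C.chartB.chart (g^[i.2 * minimalPeriod f C.B]
      (g^[C.tab + i.1 * minimalPeriod f C.A] (g^[C.tba] (R i)))) = w i := by
    rw [seg4.end_eq, hend3, ← pow_apply, SB.pow_add le_rfl, Nat.sub_self, SBP, SBQ]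
    simp [w, a']
  have seg5 := seg3.comp hgc seg4
  have hret : g^[C.length i] (R i) = R i := by
    rw [SimpleCycle.length, iterate_add_apply, iterate_add_apply]
    refine C.chartB.chart.injOn seg4.end_mem hRs ?_
    rw [hend4, hRw i hwi]
  refine ⟨hνi, hRs, by rw [hRw i hwi], fun j hj0 hj => ?_, hret,
    (conj_comp hgc hconj1 seg5.conj).mono fun z hz => hz.2.2⟩
  rcases lt_or_ge j C.tba with hjt | hjt
  · exact hV1 j hj0 hjt
  · obtain ⟨k, rfl⟩ := Nat.exists_eq_add_of_le' hjt
    rw [iterate_add_apply]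
    exact seg5.mem k (by rw [SimpleCycle.length] at hj; omega)

end Unfolding

end HeteroCycle

namespace HeteroCycle

/-! ### Least period, invariance, and multipliers of the return map. -/

section Block

variable {s u : ℕ}

theorem block_mul (a a' : EuclideanSpace ℝ (Fin s) →L[ℝ] EuclideanSpace ℝ (Fin s)) (c c' : ℝ)
    (b b' : EuclideanSpace ℝ (Fin u) →L[ℝ] EuclideanSpace ℝ (Fin u)) :
    block a c b * block a' c' b' = block (a * a') (c * c') (b * b') :=
  ContinuousLinearMap.ext fun x => Prod.ext rfl (Prod.ext (mul_assoc c c' x.2.1).symm rfl)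

theorem block_pow_eq (a : EuclideanSpace ℝ (Fin s) →L[ℝ] EuclideanSpace ℝ (Fin s)) (c : ℝ)
    (b : EuclideanSpace ℝ (Fin u) →L[ℝ] EuclideanSpace ℝ (Fin u)) (k : ℕ) :
    block a c b ^ k = block (a ^ k) (c ^ k) (b ^ k) :=
  ContinuousLinearMap.ext fun x => block_pow a c b k x

end Block

theorem minimalPeriod_eq_of_iterate_ne {α : Type*} {g : α → α} {x : α} {n : ℕ} (hn : 0 < n)
    (h : g^[n] x = x) (hne : ∀ j, 0 < j → j < n → g^[j] x ≠ x) : minimalPeriod g x = n := by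
  have h1 : IsPeriodicPt g n x := h
  refine le_antisymm (h1.minimalPeriod_le hn) (not_lt.1 fun hlt => ?_)
  exact hne _ (h1.minimalPeriod_pos hn) hlt (isPeriodicPt_minimalPeriod g x)

/-- By injectivity a `k`-th preimage of `x` is the forward iterate of order `n * k - k`, so the full
orbit is the forward one. -/
theorem mem_maximalInvariantSet_of_periodic {α : Type*} {g : α → α} (hg : Injective g) {V : Set α}
    {x : α} {n : ℕ} (hn : 0 < n) (h : g^[n] x = x) (hV : ∀ j < n, g^[j] x ∈ V) :
    x ∈ maximalInvariantSet g V := by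
  have h1 : IsPeriodicPt g n x := h
  have key : ∀ k, g^[k] x ∈ V := fun k => by
    rw [← h1.iterate_mod_apply k]
    exact hV _ (Nat.mod_lt _ hn)
  rintro q ⟨k, rfl | hq⟩
  · exact key k
  · have h2 : g^[k] q = g^[k] (g^[n * k - k] x) := by
      rw [hq, ← iterate_add_apply, Nat.add_sub_cancel' (Nat.le_mul_of_pos_left k hn)]
      exact (h1.mul_const k).symm
    rw [hg.iterate k h2]
    exact key _

namespace SimpleCycle

variable {s u : ℕ} {M : Type*} [TopologicalSpace M]
  [ChartedSpace (EuclideanSpace ℝ (Fin (s + 1 + u))) M]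
  {f : Diffeomorph (𝓡 (s + 1 + u)) (𝓡 (s + 1 + u)) M M 1} (C : SimpleCycle s u f)

theorem length_pos (i : ℕ × ℕ) : 0 < C.length i := Nat.add_pos_right _ C.tba_pos

/-- The strong stable block of the return map along an itinerary. -/
noncomputable def returnStable (i : ℕ × ℕ) :
    EuclideanSpace ℝ (Fin s) →L[ℝ] EuclideanSpace ℝ (Fin s) :=
  C.chartB.stable ^ i.2 * C.Tab.ts * C.chartA.stable ^ i.1 * C.Tba.ts

/-- The strong unstable block of the return map along an itinerary. -/
noncomputable def returnUnstable (i : ℕ × ℕ) :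
    EuclideanSpace ℝ (Fin u) →L[ℝ] EuclideanSpace ℝ (Fin u) :=
  C.chartB.unstable ^ i.2 * (C.Tab.tu : EuclideanSpace ℝ (Fin u) →L[ℝ] EuclideanSpace ℝ (Fin u)) *
    C.chartA.unstable ^ i.1 * (C.Tba.tu : EuclideanSpace ℝ (Fin u) →L[ℝ] EuclideanSpace ℝ (Fin u))

/-- The central multiplier of the return map along an itinerary. -/
noncomputable def returnCentral (i : ℕ × ℕ) : ℝ :=
  C.chartB.lam ^ i.2 * C.Tab.sign * C.chartA.lam ^ i.1 * C.Tba.sign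

theorem abs_returnCentral (i : ℕ × ℕ) :
    |C.returnCentral i| = |C.chartB.lam ^ i.2 * C.chartA.lam ^ i.1| := by
  simp [returnCentral, abs_mul, AffineTransition.abs_sign]

theorem hasFDerivAt_itinerary (ν : ℝ) (i : ℕ × ℕ) (x : Coord s u) :
    HasFDerivAt (C.itinerary ν i)
      (block (C.returnStable i) (C.returnCentral i) (C.returnUnstable i)) x := by
  have h1 : ∀ (T : Coord s u →L[ℝ] Coord s u) (k : ℕ) (y : Coord s u),
      HasFDerivAt T^[k] (T ^ k) y := fun T k y => by
    have : T^[k] = ⇑(T ^ k) := funext fun z => (pow_apply T k z).symm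
    rw [this]
    exact (T ^ k).hasFDerivAt
  have h := ((h1 C.chartB.L i.2 _).comp _ (((C.Tab.hasFDerivAt _).add_const (0, ν, 0)).comp _
    (h1 C.chartA.L i.1 (C.Tba.toFun x)))).comp x (C.Tba.hasFDerivAt x)
  have hD : block (C.returnStable i) (C.returnCentral i) (C.returnUnstable i) =
      C.chartB.L ^ i.2 * C.Tab.deriv * C.chartA.L ^ i.1 * C.Tba.deriv := by
    rw [C.chartA.L_eq, C.chartB.L_eq, block_pow_eq, block_pow_eq, AffineTransition.deriv,
      AffineTransition.deriv, block_mul, block_mul, block_mul]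
    rfl
  rw [hD]
  exact h

/-- With `μ = ± λ_B^m λ_A^l`, one has `|λ_A|^l ≤ min(1, |μ|)` and `|λ_B|^m ≥ max(1, |μ|)`. It is
thus enough that the stable eigenvalues lie strictly below `|λ_A|^l` and the unstable ones strictly
above `|λ_B|^m`. -/
theorem eventually_isCentralMultiplier :
    ∀ᶠ i in atTop, IsCentralMultiplier s (eigenvalues
      (block (C.returnStable i) (C.returnCentral i) (C.returnUnstable i) :
        Coord s u →ₗ[ℝ] Coord s u)) (C.returnCentral i) := by
  have hlA := C.chartA.lam_ne_zero f.continuous f.injective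
  have hlB := C.chartB.lam_ne_zero f.continuous f.injective
  obtain ⟨bA, -, hA2, hbA, -⟩ := C.chartA.exists_unstable_inverse hlA
  obtain ⟨bB, -, hB2, -, hbB⟩ := C.chartB.exists_unstable_inverse hlB
  have hinv : ∀ (T T' : EuclideanSpace ℝ (Fin u) →L[ℝ] EuclideanSpace ℝ (Fin u)),
      (∀ x, T' (T x) = x) → ∀ (k : ℕ) x, (T' ^ k) ((T ^ k) x) = x := fun T T' h k x => by
    rw [pow_apply, pow_apply]
    exact LeftInverse.iterate h k x
  filter_upwards [eventually_norm_lt_pow C.Tab.ts C.Tba.ts (abs_pos.2 hlA)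
      (C.chartA.tendsto_stable_pow_smul hlA) C.chartB.tendsto_stable_pow,
    eventually_norm_mul_pow_lt
      (C.Tba.tu.symm : EuclideanSpace ℝ (Fin u) →L[ℝ] EuclideanSpace ℝ (Fin u))
      (C.Tab.tu.symm : EuclideanSpace ℝ (Fin u) →L[ℝ] EuclideanSpace ℝ (Fin u))
      (abs_pos.2 hlB) hbA hbB] with i hs hu
  have hA1 : |C.chartA.lam| ^ i.1 ≤ 1 := pow_le_one₀ (abs_nonneg _) C.central_A.le
  have hB1 : 1 ≤ |C.chartB.lam| ^ i.2 := one_le_pow₀ C.central_B.le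
  have hμ : |C.returnCentral i| = |C.chartB.lam| ^ i.2 * |C.chartA.lam| ^ i.1 := by
    rw [abs_returnCentral, abs_mul, abs_pow, abs_pow]
  have hA0 : 0 ≤ |C.chartA.lam| ^ i.1 := by positivity
  refine ⟨_, _, eigenvalues_block _ _ _, ?_, fun z hz => ?_, fun z hz => ?_⟩
  · rw [card_eigenvalues, finrank_euclideanSpace_fin]
  · have h1 : ‖z‖ < |C.chartA.lam| ^ i.1 := (norm_le_of_mem_eigenvalues hz).trans_lt hs
    exact ⟨h1.trans_le (hμ ▸ le_mul_of_one_le_left hA0 hB1), h1.trans_le hA1⟩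
  -- `T'` is the inverse of the unstable block. Its small norm bounds the eigenvalues of the block
  -- from below.
  · set T' := (C.Tba.tu.symm : EuclideanSpace ℝ (Fin u) →L[ℝ] EuclideanSpace ℝ (Fin u)) *
      bA ^ i.1 * (C.Tab.tu.symm : EuclideanSpace ℝ (Fin u) →L[ℝ] EuclideanSpace ℝ (Fin u)) *
      bB ^ i.2 with hT'
    have h1 := one_le_of_mem_eigenvalues (L := C.returnUnstable i) (L' := T') (fun v => ?_) hz
    · have h2 : |C.chartB.lam| ^ i.2 < ‖z‖ := by
        refine lt_of_mul_lt_mul_left (hu.trans_le h1) (norm_nonneg _)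
      exact ⟨(hμ ▸ mul_le_of_le_one_right (by positivity) hA1).trans_lt h2, hB1.trans_lt h2⟩
    · simp only [hT', returnUnstable, mul_apply_eq_comp, ContinuousLinearEquiv.coe_coe]
      rw [hinv _ _ hB2, ContinuousLinearEquiv.symm_apply_apply, hinv _ _ hA2,
        ContinuousLinearEquiv.symm_apply_apply]

end SimpleCycle

end HeteroCycle

/-! ### Conclusion. -/

theorem mainTheorem5 {s u : ℕ} {M : Type*} [TopologicalSpace M] [T2Space M] [CompactSpace M]
    [ChartedSpace (EuclideanSpace ℝ (Fin (s + 1 + u))) M] [IsManifold (𝓡 (s + 1 + u)) 1 M]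
    (f : Diffeomorph (𝓡 (s + 1 + u)) (𝓡 (s + 1 + u)) M M 1)
    (C : HeteroCycle.SimpleCycle s u f) (F : HeteroCycle.Unfolding C) :
    ∃ (ν : ℕ → ℕ → ℝ) (R : ℕ → ℕ → M),
      Tendsto (fun p : ℕ × ℕ => ν p.1 p.2) atTop (𝓝 0) ∧
      -- the strong coordinates of `R` tend to `0`, resp. to the (stable, unstable) ones of `X⁻`
      (C.chartB.chart C.Xm).1 = 0 ∧
      Tendsto (fun p : ℕ × ℕ => (C.chartB.chart (R p.1 p.2)).1) atTop (𝓝 0) ∧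
      Tendsto (fun p : ℕ × ℕ => (C.chartB.chart (R p.1 p.2)).2.2 - (C.chartB.chart C.Xm).2.2)
        atTop (𝓝 0) ∧
      ∃ N : ℕ, ∀ l m : ℕ, N ≤ l → N ≤ m →
        |ν l m| < F.ν₀ ∧
        R l m ∈ C.chartB.chart.source ∧
        (C.chartB.chart (R l m)).2.1 = (C.chartB.chart C.Xm).2.1 ∧
        R l m ∈ HeteroCycle.maximalInvariantSet (F.map (ν l m)) C.V₀ ∧
        R l m ∈ periodicPts (F.map (ν l m)) ∧
        minimalPeriod (F.map (ν l m)) (R l m) =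
          m * minimalPeriod f C.B + l * minimalPeriod f C.A + C.tab + C.tba ∧
        ∃ μ : ℝ,
          HeteroCycle.IsCentralMultiplier s
            (HeteroCycle.multipliers (d := s + 1 + u) (F.map (ν l m)) (R l m)) μ ∧
          |μ| = |C.chartB.lam ^ m * C.chartA.lam ^ l| ∧
          (HeteroCycle.IsHyperbolicAt (s + 1 + u) (F.map (ν l m)) (R l m) →
            (|μ| < 1 ∧ HeteroCycle.index (s + 1 + u) (F.map (ν l m)) (R l m) =
              HeteroCycle.index (s + 1 + u) f C.A) ∨
            (1 < |μ| ∧ HeteroCycle.index (s + 1 + u) (F.map (ν l m)) (R l m) =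
              HeteroCycle.index (s + 1 + u) f C.B)) := by
  obtain ⟨V, hVo, hV₀, hVp, hXV⟩ := C.exists_open_superset
  obtain ⟨hX1, ν, R, hν, hR, hchart, hev⟩ := F.exists_periodic_orbits hVo hVp
  refine ⟨fun l m => ν (l, m), fun l m => R (l, m), hν, hX1, ?_, ?_, ?_⟩
  · have := (continuous_fst.tendsto _).comp hchart
    rwa [hX1] at this
  · have := ((continuous_snd.comp continuous_snd).tendsto _).comp hchart
    simpa using this.sub_const (C.chartB.chart C.Xm).2.2
  · have hXV₀ : C.Xm ∈ C.V₀ := C.subset_V₀ (Or.inl (Or.inr ⟨0, Or.inl rfl⟩))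
    obtain ⟨⟨N₁, N₂⟩, hN⟩ := eventually_atTop.1 ((hev.and (hR.eventually hXV)).and
      ((hR.eventually (C.isOpen_V₀.mem_nhds hXV₀)).and C.eventually_isCentralMultiplier))
    refine ⟨max N₁ N₂, fun l m hl hm => ?_⟩
    obtain ⟨⟨⟨h1, h2, h3, h4, h5, h6⟩, h7⟩, h8, h9⟩ := hN (l, m)
      ⟨(le_max_left _ _).trans hl, (le_max_right _ _).trans hm⟩
    have hpos := C.length_pos (l, m)
    have hper : minimalPeriod (F.map (ν (l, m))) (R (l, m)) = C.length (l, m) :=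
      -- An early return would place `R` in `V` by `h4`, but `R` is near `X⁻` and hence outside `V`
      -- by `h7`.
      HeteroCycle.minimalPeriod_eq_of_iterate_ne hpos h5 fun j hj0 hj h =>
        h7 (h ▸ h4 j hj0 hj)
    have hmult : HeteroCycle.multipliers (d := s + 1 + u) (F.map (ν (l, m))) (R (l, m)) = _ :=
      HeteroCycle.multipliers_eq (F.map (ν (l, m))) C.chartB.contMDiffOn_chart
        C.chartB.contMDiffOn_symm h2 (C.hasFDerivAt_itinerary _ _ _)
        (by rw [hper]; exact h6)
    rw [← hmult] at h9
    refine ⟨h1, h2, h3, ?_, ⟨_, hpos, h5⟩, ?_, C.returnCentral (l, m), h9,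
      C.abs_returnCentral (l, m), fun hhyp => ?_⟩
    · refine HeteroCycle.mem_maximalInvariantSet_of_periodic (F.map (ν (l, m))).injective hpos h5
        fun j hj => ?_
      rcases Nat.eq_zero_or_pos j with rfl | hj0
      · exact h8
      · exact hV₀ (h4 j hj0 hj)
    · rw [hper, HeteroCycle.SimpleCycle.length]
      ring
    -- Since `μ` is itself a multiplier, hyperbolicity excludes `|μ| = 1`. The index is `u` or `u +
    -- 1` according to the side of `1` on which `|μ|` lies, as for `A` and `B`.
    · have hne := hhyp.2 _ h9.mem
      rw [Complex.norm_real, Real.norm_eq_abs] at hne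
      have hi := HeteroCycle.index_eq h9
      have hA := HeteroCycle.index_eq C.chartA.isCentralMultiplier_lam
      have hB := HeteroCycle.index_eq C.chartB.isCentralMultiplier_lam
      rcases lt_or_gt_of_ne hne with h | h
      · exact Or.inl ⟨h, (hi.1 h).trans (hA.1 C.central_A).symm⟩
      · exact Or.inr ⟨h, (hi.2 h).trans (hB.2 C.central_B).symm⟩
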